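/- **Setting.** Let $d\ge 1$ and write $|n|=\max_{1\le i\le d}|n_i|$ for $n\in\mathbb{Z}^d$. *Regions.* An elementary region of size $N\in\mathbb{N}$ centered at $0$ is the cube $[-N,N]^d$ or, if $d\ge 2$, a set $[-N,N]^d\setminus\{n\in\mathbb{Z}^d:\ n_i\,\varsigma_i\,0,\ 1\le i\le d\}$, where $\varsigma_i\in\{<,>,\emptyset\}$, at least two $\varsigma_i$ are not $\emptyset$, and $\varsigma_i=\emptyset$ imposes no condition. $\mathcal{E}_N$ is the set of all translates of these sets by elements of $\mathbb{Z}^d$. The width of a nonempty finite $\Lambda\subset\mathbb{Z}^d$ is the maximal $M\in\mathbb{N}$ such that for every $n\in\Lambda$ there is $W\in\mathcal{E}_M$ with $n\in W\subset\Lambda$ and $\mathrm{dist}(n,\Lambda\setminus W)\ge M/2$ (the distance to the empty set is $+\infty$). A generalized elementary region is a set $R\setminus(R+z)$ with $z\in\mathbb{Z}^d$ and $R=\{n\in\mathbb{Z}^d:|n_i-n_i'|\le M_i,\ 1\le i\le d\}$, where $n'\in\mathbb{Z}^d$ and $M_i\in\mathbb{N}$. For real $L,M$, $\mathcal{R}_L^M$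 is the set of generalized elementary regions of diameter at most $L$ and width at least $M$. *Green's functions.* For a complex matrix $A=(A(n,n'))_{n,n'\in\mathbb{Z}^d}$ and a finite $\Lambda\subset\mathbb{Z}^d$, $R_\Lambda AR_\Lambda$ is the restriction of $A$ to $\Lambda$, acting on $\ell^2(\Lambda)$, and $G_\Lambda=(R_\Lambda AR_\Lambda)^{-1}$. Every condition on $G_\Lambda$ below includes that $R_\Lambda AR_\Lambda$ is invertible. $\|\cdot\|$ is the operator norm on $\ell^2(\Lambda)$. **Theorem 2.1.** Let $\varsigma,\sigma,\xi\in(0,1)$ and $\sigma<\tilde\sigma\le 1$. There is $\vartheta=\vartheta(\sigma,\tilde\sigma,\xi,\varsigma)>0$ such that for all $d\ge 1$ and all $K,c_1,c_0>0$ there is $N_0$, depending only on $d,K,\varsigma,\sigma,\tilde\sigma,\xi,c_1,c_0$, with the following property. Let $$c_0\le c_2\le \frac{5^{\tilde\sigma}-1}{5^{\tilde\sigma}}\,c_1,\qquad |A(n,n')|\le Ke^{-c_1|n-n'|^{\tilde\sigma}}\quad\text{for all } n,n'\in\mathbb{Z}^d,$$ let $N\ge N_0$ be an integer, and let $\tilde\Lambda_0\in\mathcal{E}_N$.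 Suppose that 1. for all real $L$ with $N^\xi\le L\le N$ and all $\Lambda\in\mathcal{R}_L^{N^\xi}$ with $\Lambda\subset\tilde\Lambda_0$, one has $\|G_\Lambda\|\le e^{L^\sigma}$; 2. with $M=\lfloor N^\xi\rfloor$, every finite family $\mathcal{F}$ of pairwise disjoint elementary regions of size $M$ contained in $\tilde\Lambda_0$ satisfies $$\#\{\Lambda\in\mathcal{F}:\Lambda\text{ is not in class }G\}\le \frac{N^\varsigma}{N^\xi},$$ where $\Lambda\in\mathcal{E}_M$ is in class $G$ if $|G_\Lambda(n,n')|\le e^{-c_2|n-n'|^{\tilde\sigma}}$ for all $n,n'\in\Lambda$ with $|n-n'|\ge M/10$. Then $R_{\tilde\Lambda_0}AR_{\tilde\Lambda_0}$ is invertible and $$|G_{\tilde\Lambda_0}(n,n')|\le e^{-(c_2-N^{-\vartheta})|n-n'|^{\tilde\sigma}}\quad\text{for all } n,n'\in\tilde\Lambda_0\text{ with }|n-n'|\ge \frac{N}{10}.$$ -/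

import Mathlib

/-!
Lattice sites are `n : Fin d → ℤ`.  The norm `‖n‖` on this type is Mathlib's sup norm,
that is `max_i |n_i|`, and `Metric.diam` is the diameter with respect to it.
-/

namespace MSA

/-- The cube `[-N,N]^d`. -/
noncomputable def cube (d N : ℕ) : Finset (Fin d → ℤ) :=
  Fintype.piFinset fun _ => Finset.Icc (-(N : ℤ)) (N : ℤ)

/-- The cube `[-N,N]^d` without the sites `n` such that `n_i ς_i 0` for all `i`.
The relation symbols `<`, `>`, `∅` are coded by the signs `-1`, `1`, `0`;
the symbol `∅` imposes no condition. -/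
noncomputable def cutCube (d N : ℕ) (ς : Fin d → SignType) : Finset (Fin d → ℤ) :=
  (cube d N).filter fun n =>
    ¬ ∀ i, (ς i = SignType.neg → n i < 0) ∧ (ς i = SignType.pos → 0 < n i)

/-- The elementary regions of size `N` centered at `0`.  For `d = 1` there are no two
indices to cut with, so the interval `[-N,N]` is the only one. -/
def elementaryRegionsAtZero (d N : ℕ) : Set (Finset (Fin d → ℤ)) :=
  {Q | Q = cube d N ∨
    ∃ ς : Fin d → SignType, (∃ i j, i ≠ j ∧ ς i ≠ 0 ∧ ς j ≠ 0) ∧ Q = cutCube d N ς}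

/-- The elementary regions of size `N`: all translates of those centered at `0`. -/
def elementaryRegions (d N : ℕ) : Set (Finset (Fin d → ℤ)) :=
  {Λ | ∃ c : Fin d → ℤ, ∃ Q ∈ elementaryRegionsAtZero d N, Λ = Q.image fun n => c + n}

/-- Each `n ∈ Λ` lies in an elementary region `W ⊆ Λ` of size `M` such that
`dist(n, Λ \ W) ≥ M / 2` (the distance to the empty set being infinite). -/
def WidthCondition {d : ℕ} (Λ : Finset (Fin d → ℤ)) (M : ℕ) : Prop :=
  ∀ n ∈ Λ, ∃ W ∈ elementaryRegions d M,
    n ∈ W ∧ W ⊆ Λ ∧ ∀ m ∈ Λ \ W, (M : ℝ) / 2 ≤ ‖n - m‖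

/-- The width of a finite set of sites: the maximal `M` that satisfies `WidthCondition`.
For nonempty `Λ` and `d ≥ 1` the set of these `M` contains `0` and is finite, so that `sSup`
is its maximum.  (For the empty set the value is the default `0`.) -/
noncomputable def width {d : ℕ} (Λ : Finset (Fin d → ℤ)) : ℕ :=
  sSup {M : ℕ | WidthCondition Λ M}

/-- The rectangle `{n : |n_i - c_i| ≤ m_i for all i}`. -/
noncomputable def rectangle {d : ℕ} (c : Fin d → ℤ) (m : Fin d → ℕ) : Finset (Fin d → ℤ) :=
  Fintype.piFinset fun i => Finset.Icc (c i - (m i : ℤ)) (c i + (m i : ℤ))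

/-- The generalized elementary regions `R \ (R + z)`, with `R` a rectangle and `z` arbitrary. -/
def generalizedElementaryRegions (d : ℕ) : Set (Finset (Fin d → ℤ)) :=
  {Λ | ∃ (c : Fin d → ℤ) (m : Fin d → ℕ) (z : Fin d → ℤ),
    Λ = rectangle c m \ (rectangle c m).image fun n => n + z}

/-- The generalized elementary regions of diameter at most `L` and width at least `M`. -/
def wideRegions (d : ℕ) (L M : ℝ) : Set (Finset (Fin d → ℤ)) :=
  {Λ | Λ ∈ generalizedElementaryRegions d ∧
    Metric.diam (Λ : Set (Fin d → ℤ)) ≤ L ∧ M ≤ (width Λ : ℝ)}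

/-- Subexponential decay: `|A(n,n')| ≤ K exp(-c₁ |n-n'|^σ')` for all `n, n'`. -/
def SubexpDecay {d : ℕ} (A : Matrix (Fin d → ℤ) (Fin d → ℤ) ℂ) (K c₁ σ' : ℝ) : Prop :=
  ∀ n n', ‖A n n'‖ ≤ K * Real.exp (-c₁ * ‖n - n'‖ ^ σ')

/-- The restriction `R_Λ A R_Λ`, as a matrix acting on `ℓ²(Λ)`. -/
def restrict {d : ℕ} (A : Matrix (Fin d → ℤ) (Fin d → ℤ) ℂ) (Λ : Finset (Fin d → ℤ)) :
    Matrix Λ Λ ℂ :=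
  A.submatrix (fun n => (n : Fin d → ℤ)) (fun n => (n : Fin d → ℤ))

/-- The Green's function `(R_Λ A R_Λ)⁻¹`.  It is meaningful only if `R_Λ A R_Λ` is invertible,
which is required explicitly wherever it is used. -/
noncomputable def green {d : ℕ} (A : Matrix (Fin d → ℤ) (Fin d → ℤ) ℂ)
    (Λ : Finset (Fin d → ℤ)) : Matrix Λ Λ ℂ :=
  (restrict A Λ)⁻¹

/-- The operator norm of a matrix on `ℓ²(Λ)`. -/
noncomputable def opNorm {d : ℕ} {Λ : Finset (Fin d → ℤ)} (B : Matrix Λ Λ ℂ) : ℝ :=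
  ‖Matrix.toEuclideanCLM (n := Λ) (𝕜 := ℂ) B‖

/-- The Green's function on `Λ` exists and `|G_Λ(n,n')| ≤ exp(-c |n-n'|^σ')` for all
`n, n' ∈ Λ` with `|n-n'| ≥ N / 10`.  An elementary region `Λ` of size `N` is in class G
if this holds with `c = c₂`. -/
def GreenDecay {d : ℕ} (A : Matrix (Fin d → ℤ) (Fin d → ℤ) ℂ) (c σ' : ℝ) (N : ℕ)
    (Λ : Finset (Fin d → ℤ)) : Prop :=
  IsUnit (restrict A Λ) ∧
    ∀ n n' : Λ, (N : ℝ) / 10 ≤ ‖(n : Fin d → ℤ) - (n' : Fin d → ℤ)‖ →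
      ‖green A Λ n n'‖ ≤ Real.exp (-c * ‖(n : Fin d → ℤ) - (n' : Fin d → ℤ)‖ ^ σ')

end MSA

/-! ### Resolvent identities, invertibility criterion and maximum principle -/

namespace MSA

variable {d : ℕ}

/-! Rows of a Green's function are expanded over smaller regions by the resolvent identity
(`greenFn_resolvent`). If `x` lies in a class G region `W ⊆ Λ` of size `M` at distance at least
`M/2` from `Λ \ W`, the coefficient of the jump from `x` to `z ∉ W` decays like `exp(-c|x-z|^σ')`,
up to a polynomial volume and the size of the row of `G_W` (`norm_greenFn_mul_le`).

The expansion is not iterated along paths. Instead `|G_Λ(x,y)|` is compared with a barrier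
`exp((c-η)(ρ(x)-ρ(y)))` by a maximum principle (`norm_greenFn_le_of_expansions`). Here `ρ` is the
power `σ'` of a one-dimensional length, measured along the coordinate that realizes `|x₀-y|` and
skipping a finite set `Z` of values. Subadditivity of `r ↦ r^σ'` makes the barrier compatible with
jumps, and the loss `η` in the rate pays for all constants. A site without a class G region is
expanded over the part of `Λ` in a half-space that ends just before the first value outside `Z`;
only a norm bound for the inverse on that part is needed, since the way to its face is skipped. A
maximal disjoint family of bad regions shows that few bad regions keep `Z` small
(`greenDecay_of_few_bad`). That these half-space parts are wide enough for the norm bound is the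
geometry of cut boxes (`widthCondition_cutBox`, `halfspace_mem_wideRegions`).

One step from `N^ξ` to `N` would oppose inverses of size about `exp(N^σ)` to a gain of
`exp(N^(ξσ'))`, so the scale exponent grows in small increments with `a'σ < aσ'`. By the one-step
theorem a bad region of size `N^a'` contains more than `N^(a'-κ-a)` disjoint bad regions of size
`N^a`; hence the bound `N^(s-a)` on their number becomes `N^(s+κ-a')`
(`exists_forall_badCount_step`). After finitely many steps this exponent is negative and no bad
region is left. The last step (`greenDecay_of_no_bad`) proves invertibility on `Λ₀` itself, because
the diameter of `Λ₀` is too large for the assumed norm bound. -/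

/-- The Green's function of `A` on `Λ`, extended by zero to all pairs of sites. -/
noncomputable def greenFn (A : Matrix (Fin d → ℤ) (Fin d → ℤ) ℂ) (Λ : Finset (Fin d → ℤ))
    (x y : Fin d → ℤ) : ℂ :=
  if h : x ∈ Λ ∧ y ∈ Λ then green A Λ ⟨x, h.1⟩ ⟨y, h.2⟩ else 0

lemma greenFn_of_mem (A : Matrix (Fin d → ℤ) (Fin d → ℤ) ℂ) {Λ : Finset (Fin d → ℤ)}
    {x y : Fin d → ℤ} (hx : x ∈ Λ) (hy : y ∈ Λ) :
    greenFn A Λ x y = green A Λ ⟨x, hx⟩ ⟨y, hy⟩ := by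
  simp [greenFn, hx, hy]

lemma greenFn_of_not_mem_right (A : Matrix (Fin d → ℤ) (Fin d → ℤ) ℂ)
    {Λ : Finset (Fin d → ℤ)} {x y : Fin d → ℤ} (hy : y ∉ Λ) : greenFn A Λ x y = 0 := by
  simp [greenFn, hy]

lemma sum_greenFn_mul {A : Matrix (Fin d → ℤ) (Fin d → ℤ) ℂ} {Λ : Finset (Fin d → ℤ)}
    (hU : IsUnit (restrict A Λ)) {x y : Fin d → ℤ} (hx : x ∈ Λ) (hy : y ∈ Λ) :
    ∑ w ∈ Λ, greenFn A Λ x w * A w y = if x = y then 1 else 0 := by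
  have h : green A Λ * restrict A Λ = 1 :=
    Matrix.nonsing_inv_mul _ ((Matrix.isUnit_iff_isUnit_det _).1 hU)
  have h2 := congrFun (congrFun h ⟨x, hx⟩) ⟨y, hy⟩
  rw [Matrix.mul_apply, Matrix.one_apply] at h2
  simp only [Subtype.mk.injEq] at h2
  rw [← h2, ← Finset.sum_coe_sort Λ]
  refine Finset.sum_congr rfl fun w _ => ?_
  rw [greenFn_of_mem A hx w.2]
  rfl

lemma sum_mul_greenFn {A : Matrix (Fin d → ℤ) (Fin d → ℤ) ℂ} {Λ : Finset (Fin d → ℤ)}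
    (hU : IsUnit (restrict A Λ)) {x y : Fin d → ℤ} (hx : x ∈ Λ) (hy : y ∈ Λ) :
    ∑ w ∈ Λ, A x w * greenFn A Λ w y = if x = y then 1 else 0 := by
  have h : restrict A Λ * green A Λ = 1 :=
    Matrix.mul_nonsing_inv _ ((Matrix.isUnit_iff_isUnit_det _).1 hU)
  have h2 := congrFun (congrFun h ⟨x, hx⟩) ⟨y, hy⟩
  rw [Matrix.mul_apply, Matrix.one_apply] at h2
  simp only [Subtype.mk.injEq] at h2
  rw [← h2, ← Finset.sum_coe_sort Λ]
  refine Finset.sum_congr rfl fun w _ => ?_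
  rw [greenFn_of_mem A w.2 hy]
  rfl

/-- Representation of `v` at a site of `W` by `A v` on `W` and the values of `v` outside `W`. -/
lemma eq_sum_greenFn_sub {A : Matrix (Fin d → ℤ) (Fin d → ℤ) ℂ} {W Λ : Finset (Fin d → ℤ)}
    (hU : IsUnit (restrict A W)) (hW : W ⊆ Λ) (v : (Fin d → ℤ) → ℂ) {x : Fin d → ℤ}
    (hx : x ∈ W) :
    v x = ∑ w ∈ W, greenFn A W x w * ∑ z ∈ Λ, A w z * v z
      - ∑ z ∈ Λ \ W, (∑ w ∈ W, greenFn A W x w * A w z) * v z := by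
  have h1 : ∑ w ∈ W, greenFn A W x w * ∑ z ∈ Λ, A w z * v z
      = ∑ z ∈ Λ, (∑ w ∈ W, greenFn A W x w * A w z) * v z := by
    simp_rw [Finset.mul_sum, Finset.sum_mul]
    rw [Finset.sum_comm]
    simp_rw [mul_assoc]
  rw [h1, ← Finset.sum_sdiff hW, add_sub_cancel_left]
  have h2 : ∀ z ∈ W, (∑ w ∈ W, greenFn A W x w * A w z) * v z
      = if x = z then v z else 0 := by
    intro z hz
    rw [sum_greenFn_mul hU hx hz, ite_mul, one_mul, zero_mul]
  rw [Finset.sum_congr rfl h2, Finset.sum_ite_eq, if_pos hx]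

/-- The resolvent identity. -/
lemma greenFn_resolvent {A : Matrix (Fin d → ℤ) (Fin d → ℤ) ℂ} {W Λ : Finset (Fin d → ℤ)}
    (hU : IsUnit (restrict A W)) (hUΛ : IsUnit (restrict A Λ)) (hW : W ⊆ Λ)
    {x y : Fin d → ℤ} (hx : x ∈ W) (hy : y ∈ Λ) :
    greenFn A Λ x y = greenFn A W x y
      - ∑ z ∈ Λ \ W, (∑ w ∈ W, greenFn A W x w * A w z) * greenFn A Λ z y := by
  refine (eq_sum_greenFn_sub hU hW (fun z => greenFn A Λ z y) hx).trans ?_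
  congr 1
  have h2 : ∀ w ∈ W, greenFn A W x w * ∑ z ∈ Λ, A w z * greenFn A Λ z y
      = if w = y then greenFn A W x w else 0 := by
    intro w hw
    rw [sum_mul_greenFn hUΛ (hW hw) hy, mul_ite, mul_one, mul_zero]
  rw [Finset.sum_congr rfl h2, Finset.sum_ite_eq']
  -- For `y` outside `W` the source term is absent, in agreement with the extension of the Green's
  -- function by zero.
  split_ifs with hyW
  · rfl
  · rw [greenFn_of_not_mem_right A hyW]

lemma norm_apply_le_opNorm {Λ : Finset (Fin d → ℤ)} (B : Matrix Λ Λ ℂ) (i j : Λ) :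
    ‖B i j‖ ≤ opNorm B := by
  have h1 : Matrix.toEuclideanCLM (n := Λ) (𝕜 := ℂ) B (EuclideanSpace.single j 1) i = B i j := by
    have := congrFun (Matrix.ofLp_toEuclideanCLM (𝕜 := ℂ) B (EuclideanSpace.single j 1)) i
    rw [this]
    simp
  rw [← h1]
  refine (PiLp.norm_apply_le _ i).trans ?_
  refine (ContinuousLinearMap.le_opNorm _ _).trans ?_
  simp [opNorm]

lemma norm_greenFn_le_opNorm (A : Matrix (Fin d → ℤ) (Fin d → ℤ) ℂ) (Λ : Finset (Fin d → ℤ))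
    (x y : Fin d → ℤ) : ‖greenFn A Λ x y‖ ≤ opNorm (green A Λ) := by
  by_cases h : x ∈ Λ ∧ y ∈ Λ
  · rw [greenFn_of_mem A h.1 h.2]
    exact norm_apply_le_opNorm _ _ _
  · simp [greenFn, h, opNorm]

lemma greenDecay_iff {A : Matrix (Fin d → ℤ) (Fin d → ℤ) ℂ} {c σ' : ℝ} {N : ℕ}
    {Λ : Finset (Fin d → ℤ)} :
    GreenDecay A c σ' N Λ ↔ IsUnit (restrict A Λ) ∧ ∀ x ∈ Λ, ∀ y ∈ Λ, (N : ℝ) / 10 ≤ ‖x - y‖ →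
      ‖greenFn A Λ x y‖ ≤ Real.exp (-c * ‖x - y‖ ^ σ') := by
  refine and_congr_right fun _ => ⟨fun h x hx y hy hxy => ?_, fun h x y hxy => ?_⟩
  · rw [greenFn_of_mem A hx hy]
    exact h ⟨x, hx⟩ ⟨y, hy⟩ hxy
  · have := h x x.2 y y.2 hxy
    rwa [greenFn_of_mem A x.2 y.2] at this

/-- A matrix is invertible on `Λ` if its kernel on `Λ` is trivial. -/
lemma isUnit_restrict_of_ker {A : Matrix (Fin d → ℤ) (Fin d → ℤ) ℂ} {Λ : Finset (Fin d → ℤ)}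
    (h : ∀ v : (Fin d → ℤ) → ℂ, (∀ x ∈ Λ, ∑ z ∈ Λ, A x z * v z = 0) → ∀ x ∈ Λ, v x = 0) :
    IsUnit (restrict A Λ) := by
  rw [← Matrix.mulVec_injective_iff_isUnit, ← Matrix.coe_mulVecLin,
    ← LinearMap.ker_eq_bot, LinearMap.ker_eq_bot']
  intro v hv
  have h2 := h (fun x => if hx : x ∈ Λ then v ⟨x, hx⟩ else 0) (fun x hx => by
    have h3 := congrFun hv ⟨x, hx⟩
    simp only [Matrix.mulVecLin_apply, Matrix.mulVec, dotProduct, Pi.zero_apply] at h3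
    rw [← Finset.sum_coe_sort Λ, ← h3]
    refine Finset.sum_congr rfl fun z _ => ?_
    simp [restrict])
  ext x
  simpa using h2 x x.2

/-- A maximum principle: `u ≤ t h` implies `u ≤ (t + 1) / 2 h` for every `t ≥ 0`, hence
`u ≤ h`. -/
lemma le_of_contraction {ι : Type*} {Λ : Finset ι} {u h : ι → ℝ} (hu : ∀ x ∈ Λ, 0 ≤ u x)
    (hh : ∀ x ∈ Λ, 0 < h x)
    (H : ∀ t : ℝ, 0 ≤ t → (∀ z ∈ Λ, u z ≤ t * h z) → ∀ x ∈ Λ, u x ≤ (t + 1) / 2 * h x) :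
    ∀ x ∈ Λ, u x ≤ h x := by
  intro x hx
  -- With `t` the largest ratio `u / h`, the hypothesis gives `t ≤ (t + 1) / 2`, that is `t ≤ 1`.
  obtain ⟨m, hm, hmax⟩ := Finset.exists_max_image Λ (fun z => u z / h z) ⟨x, hx⟩
  have h1 := H (u m / h m) (div_nonneg (hu m hm) (hh m hm).le)
    (fun z hz => (div_le_iff₀ (hh z hz)).1 (hmax z hz)) m hm
  rw [← div_le_iff₀ (hh m hm)] at h1
  have h2 := (div_le_iff₀ (hh x hx)).1 (hmax x hx)
  have h3 : u m / h m ≤ 1 := by linarith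
  nlinarith [hh x hx]

/-! ### Decay of the coefficients in the resolvent expansion -/

section decay

variable {A : Matrix (Fin d → ℤ) (Fin d → ℤ) ℂ} {K c₁ c σ' : ℝ}

lemma rpow_le_rpow_add_of_le_add {a b r p : ℝ} (ha : 0 ≤ a) (hb : 0 ≤ b) (hr : 0 ≤ r)
    (hp : 0 ≤ p) (hp1 : p ≤ 1) (h : a ≤ b + r) : a ^ p ≤ b ^ p + r ^ p :=
  (Real.rpow_le_rpow ha h hp).trans (Real.rpow_add_le_add_rpow hb hr hp hp1)

lemma norm_sub_rpow_le (x w z : Fin d → ℤ) (h0 : 0 ≤ σ') (h1 : σ' ≤ 1) :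
    ‖x - z‖ ^ σ' ≤ ‖x - w‖ ^ σ' + ‖w - z‖ ^ σ' :=
  rpow_le_rpow_add_of_le_add (norm_nonneg _) (norm_nonneg _) (norm_nonneg _) h0 h1
    (norm_sub_le_norm_sub_add_norm_sub x w z)

lemma SubexpDecay.norm_le (hA : SubexpDecay A K c₁ σ') (hK : 0 ≤ K) (hc₁ : 0 ≤ c₁)
    (x y : Fin d → ℤ) : ‖A x y‖ ≤ K := by
  refine (hA x y).trans (mul_le_of_le_one_right hK (Real.exp_le_one_iff.2 ?_))
  have : 0 ≤ ‖x - y‖ ^ σ' := by positivity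
  nlinarith

/-- If `w` is five times closer to `x` than `z`, then the decay from `w` to `z` at rate `c₁`
is as good as the decay from `x` to `z` at rate `c`. -/
lemma mul_rpow_le_of_near (hσ0 : 0 < σ') (hσ1 : σ' ≤ 1) (hc₁ : 0 ≤ c₁)
    (hc : c ≤ ((5 : ℝ) ^ σ' - 1) / (5 : ℝ) ^ σ' * c₁) {x w z : Fin d → ℤ} {M : ℝ}
    (hw : ‖x - w‖ < M / 10) (hz : M / 2 ≤ ‖x - z‖) :
    c * ‖x - z‖ ^ σ' ≤ c₁ * ‖w - z‖ ^ σ' := by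
  have h5 : (0 : ℝ) < 5 ^ σ' := by positivity
  have h1 := norm_sub_rpow_le x w z hσ0.le hσ1
  have h2 : ‖x - w‖ ^ σ' ≤ (‖x - z‖ / 5) ^ σ' :=
    Real.rpow_le_rpow (norm_nonneg _) (by linarith) hσ0.le
  rw [Real.div_rpow (norm_nonneg _) (by norm_num)] at h2
  set p := ‖x - z‖ ^ σ'
  have hp : 0 ≤ p := by positivity
  -- Since `|x-w| ≤ |x-z| / 5`, subadditivity leaves `|w-z|^σ' ≥ (1 - 5^(-σ')) |x-z|^σ'`; this is
  -- the source of the constant in the bound on the rate.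
  have h3 : ((5 : ℝ) ^ σ' - 1) / (5 : ℝ) ^ σ' * p ≤ ‖w - z‖ ^ σ' := by
    have : ((5 : ℝ) ^ σ' - 1) / (5 : ℝ) ^ σ' * p = p - p / 5 ^ σ' := by field_simp
    rw [this]; linarith
  calc c * p ≤ ((5 : ℝ) ^ σ' - 1) / (5 : ℝ) ^ σ' * c₁ * p := by gcongr
    _ = c₁ * (((5 : ℝ) ^ σ' - 1) / (5 : ℝ) ^ σ' * p) := by ring
    _ ≤ _ := by gcongr

lemma rate_le (hc₁ : 0 ≤ c₁)
    (hc : c ≤ ((5 : ℝ) ^ σ' - 1) / (5 : ℝ) ^ σ' * c₁) : c ≤ c₁ := by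
  have h5 : (0 : ℝ) < 5 ^ σ' := by positivity
  refine hc.trans (mul_le_of_le_one_left hc₁ ?_)
  rw [div_le_one h5]; linarith

/-- Bound for the terms `G_W(x,w) A(w,z)` of the resolvent expansion. -/
lemma norm_greenFn_mul_le (hA : SubexpDecay A K c₁ σ') (hK : 0 ≤ K) (hσ0 : 0 < σ')
    (hσ1 : σ' ≤ 1) (hc₀ : 0 ≤ c) (hc₁ : 0 ≤ c₁)
    (hc : c ≤ ((5 : ℝ) ^ σ' - 1) / (5 : ℝ) ^ σ' * c₁)
    {W : Finset (Fin d → ℤ)} {M : ℕ} (hG : GreenDecay A c σ' M W) {x w z : Fin d → ℤ}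
    (hx : x ∈ W) (hw : w ∈ W) (hz : (M : ℝ) / 2 ≤ ‖x - z‖) :
    ‖greenFn A W x w * A w z‖ ≤
      max 1 ‖greenFn A W x w‖ * K * Real.exp (-c * ‖x - z‖ ^ σ') := by
  rw [norm_mul]
  -- Near `x` nothing is known about `G_W` beyond its size, and the decay of `A` covers the whole
  -- jump. Away from `x` the decay of `G_W` and that of `A` combine by subadditivity, without a
  -- prefactor from `G_W`; the maximum with `1` covers both cases.
  rcases lt_or_ge ‖x - w‖ ((M : ℝ) / 10) with h | h
  · have h1 := mul_rpow_le_of_near hσ0 hσ1 hc₁ hc h hz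
    calc ‖greenFn A W x w‖ * ‖A w z‖
        ≤ max 1 ‖greenFn A W x w‖ * (K * Real.exp (-c₁ * ‖w - z‖ ^ σ')) :=
          mul_le_mul (le_max_right _ _) (hA w z) (norm_nonneg _) (by positivity)
      _ ≤ max 1 ‖greenFn A W x w‖ * (K * Real.exp (-c * ‖x - z‖ ^ σ')) := by
          gcongr ?_ * (K * Real.exp ?_)
          linarith
      _ = _ := by ring
  · have h1 := (greenDecay_iff.1 hG).2 x hx w hw h
    have h2 := norm_sub_rpow_le x w z hσ0.le hσ1
    have h3 : c ≤ c₁ := rate_le hc₁ hc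
    have h4 : 0 ≤ ‖w - z‖ ^ σ' := by positivity
    calc ‖greenFn A W x w‖ * ‖A w z‖
        ≤ Real.exp (-c * ‖x - w‖ ^ σ') * (K * Real.exp (-c₁ * ‖w - z‖ ^ σ')) :=
          mul_le_mul h1 (hA w z) (norm_nonneg _) (by positivity)
      _ = 1 * K * Real.exp (-c * ‖x - w‖ ^ σ' + -c₁ * ‖w - z‖ ^ σ') := by
          rw [Real.exp_add]; ring
      _ ≤ max 1 ‖greenFn A W x w‖ * K * Real.exp (-c * ‖x - z‖ ^ σ') := by
          gcongr
          · exact le_max_left _ _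
          · nlinarith

lemma norm_sum_greenFn_mul_le (hA : SubexpDecay A K c₁ σ') (hK : 0 ≤ K) (hσ0 : 0 < σ')
    (hσ1 : σ' ≤ 1) (hc₀ : 0 ≤ c) (hc₁ : 0 ≤ c₁)
    (hc : c ≤ ((5 : ℝ) ^ σ' - 1) / (5 : ℝ) ^ σ' * c₁)
    {W : Finset (Fin d → ℤ)} {M : ℕ} (hG : GreenDecay A c σ' M W) {x z : Fin d → ℤ}
    {B V : ℝ} (hB : 1 ≤ B) (hxB : ∀ w ∈ W, ‖greenFn A W x w‖ ≤ B) (hV : (W.card : ℝ) ≤ V)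
    (hx : x ∈ W) (hz : (M : ℝ) / 2 ≤ ‖x - z‖) :
    ‖∑ w ∈ W, greenFn A W x w * A w z‖ ≤ V * B * K * Real.exp (-c * ‖x - z‖ ^ σ') := by
  refine (norm_sum_le _ _).trans ?_
  calc ∑ w ∈ W, ‖greenFn A W x w * A w z‖
      ≤ ∑ _w ∈ W, B * K * Real.exp (-c * ‖x - z‖ ^ σ') := by
        refine Finset.sum_le_sum fun w hw => ?_
        refine (norm_greenFn_mul_le hA hK hσ0 hσ1 hc₀ hc₁ hc hG hx hw hz).trans ?_
        gcongr
        exact max_le hB (hxB w hw)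
    _ = (W.card : ℝ) * (B * K * Real.exp (-c * ‖x - z‖ ^ σ')) := by
        rw [Finset.sum_const, nsmul_eq_mul]
    _ ≤ V * (B * K * Real.exp (-c * ‖x - z‖ ^ σ')) := by gcongr
    _ = _ := by ring

/-- The Green's function of a region with Green's function decay is bounded near the diagonal,
in rows far from the relative boundary, if the region lies in one with bounded inverse. -/
lemma norm_greenFn_le_of_subset (hA : SubexpDecay A K c₁ σ') (hK : 0 ≤ K) (hσ0 : 0 < σ')
    (hσ1 : σ' ≤ 1) (hc₀ : 0 ≤ c) (hc₁ : 0 ≤ c₁)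
    (hc : c ≤ ((5 : ℝ) ^ σ' - 1) / (5 : ℝ) ^ σ' * c₁)
    {W U : Finset (Fin d → ℤ)} {M : ℕ} (hG : GreenDecay A c σ' M W) (hWU : W ⊆ U)
    (hU : IsUnit (restrict A U)) {E V : ℝ} (hE : 1 ≤ E) (hUE : opNorm (green A U) ≤ E)
    (hV : (U.card : ℝ) ≤ V)
    (hsmall : V ^ 2 * K * E * Real.exp (-c * ((M : ℝ) / 2) ^ σ') ≤ 1 / 2)
    {x : Fin d → ℤ} (hx : x ∈ W) (hz : ∀ z ∈ U \ W, (M : ℝ) / 2 ≤ ‖x - z‖) :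
    ∀ y ∈ W, ‖greenFn A W x y‖ ≤ 2 * E := by
  -- The largest entry `a` of the row serves as its own a priori bound in the resolvent identity
  -- between `W` and `U`; this yields `a ≤ E + a / 2`.
  obtain ⟨m, hm, hmax⟩ := Finset.exists_max_image W (fun w => ‖greenFn A W x w‖) ⟨x, hx⟩
  intro y hy
  refine (hmax y hy).trans ?_
  set a := ‖greenFn A W x m‖
  by_contra! hcon
  have ha : 1 ≤ a := by linarith
  have hV0 : 0 ≤ V := le_trans (by positivity) hV
  have h1 := greenFn_resolvent hG.1 hU hWU hx (hWU hm)
  have h2 : a ≤ ‖greenFn A U x m‖ +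
      ‖∑ z ∈ U \ W, (∑ w ∈ W, greenFn A W x w * A w z) * greenFn A U z m‖ := by
    have : greenFn A W x m = greenFn A U x m +
      ∑ z ∈ U \ W, (∑ w ∈ W, greenFn A W x w * A w z) * greenFn A U z m := by
      rw [h1]; ring
    exact (congrArg norm this).le.trans (norm_add_le _ _)
  have h3 : ‖∑ z ∈ U \ W, (∑ w ∈ W, greenFn A W x w * A w z) * greenFn A U z m‖
      ≤ a * (1 / 2) := by
    refine (norm_sum_le _ _).trans ?_
    calc ∑ z ∈ U \ W, ‖(∑ w ∈ W, greenFn A W x w * A w z) * greenFn A U z m‖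
        ≤ ∑ _z ∈ U \ W, V * a * K * Real.exp (-c * ((M : ℝ) / 2) ^ σ') * E := by
          refine Finset.sum_le_sum fun z hzz => ?_
          rw [norm_mul]
          have hMz := hz z hzz
          have hpw : ((M : ℝ) / 2) ^ σ' ≤ ‖x - z‖ ^ σ' :=
            Real.rpow_le_rpow (by positivity) hMz hσ0.le
          have hVW : (W.card : ℝ) ≤ V :=
            le_trans (by exact_mod_cast Finset.card_le_card hWU) hV
          have h5 := norm_sum_greenFn_mul_le hA hK hσ0 hσ1 hc₀ hc₁ hc hG ha hmax hVW hx hMz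
          refine mul_le_mul (h5.trans ?_) ((norm_greenFn_le_opNorm _ _ _ _).trans hUE)
            (norm_nonneg _) (by positivity)
          gcongr ?_ * Real.exp ?_
          nlinarith
      _ = ((U \ W).card : ℝ) * (V * a * K * Real.exp (-c * ((M : ℝ) / 2) ^ σ') * E) := by
          rw [Finset.sum_const, nsmul_eq_mul]
      _ ≤ V * (V * a * K * Real.exp (-c * ((M : ℝ) / 2) ^ σ') * E) := by
          gcongr
          exact le_trans (by exact_mod_cast Finset.card_le_card Finset.sdiff_subset) hV
      _ = a * (V ^ 2 * K * E * Real.exp (-c * ((M : ℝ) / 2) ^ σ')) := by ring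
      _ ≤ _ := by gcongr
  have h4 := (norm_greenFn_le_opNorm A U x m).trans hUE
  linarith

end decay

end MSA

/-! ### Decay by a barrier that skips bad layers -/

namespace MSA

variable {d : ℕ}

/-- The number of integers in `[s, t)` outside `Z`. -/
noncomputable def effLength (Z : Finset ℤ) (s t : ℤ) : ℕ := (Finset.Ico s t \ Z).card

lemma effLength_mono (Z : Finset ℤ) (s : ℤ) {t t' : ℤ} (h : t ≤ t') :
    effLength Z s t ≤ effLength Z s t' :=
  Finset.card_le_card (Finset.sdiff_subset_sdiff (Finset.Ico_subset_Ico_right h) subset_rfl)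

lemma effLength_self (Z : Finset ℤ) (s : ℤ) : effLength Z s s = 0 := by
  simp [effLength]

lemma effLength_le_add (Z : Finset ℤ) (s : ℤ) {t t' : ℤ} (h : t ≤ t') :
    (effLength Z s t' : ℝ) ≤ effLength Z s t + (t' - t) := by
  have h1 : Finset.Ico s t' \ Z ⊆ (Finset.Ico s t \ Z) ∪ Finset.Ico t t' := by
    intro a ha
    simp only [Finset.mem_sdiff, Finset.mem_Ico, Finset.mem_union] at ha ⊢
    rcases lt_or_ge a t with h2 | h2
    · exact Or.inl ⟨⟨ha.1.1, h2⟩, ha.2⟩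
    · exact Or.inr ⟨h2, ha.1.2⟩
  have h2 := (Finset.card_le_card h1).trans (Finset.card_union_le _ _)
  rw [Int.card_Ico] at h2
  have h3 : ((t' - t).toNat : ℝ) = t' - t := by
    have : ((t' - t).toNat : ℤ) = t' - t := Int.toNat_of_nonneg (by omega)
    exact_mod_cast congrArg (Int.cast (R := ℝ)) this
  rw [← h3]
  exact_mod_cast h2

/-- Skipping values never lengthens a path, so a jump raises the barrier by no more than its true
length allows. -/
lemma effLength_le_add_abs (Z : Finset ℤ) (s t t' : ℤ) :
    (effLength Z s t' : ℝ) ≤ effLength Z s t + |(t' : ℝ) - t| := by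
  rcases le_total t t' with h | h
  · exact (effLength_le_add Z s h).trans (by gcongr; exact le_abs_self _)
  · have : (effLength Z s t' : ℝ) ≤ effLength Z s t := by exact_mod_cast effLength_mono Z s h
    linarith [abs_nonneg ((t' : ℝ) - t)]

/-- Crossing a block contained in `Z` is free. This is why a bad site can be expanded over a region
that reaches to the end of its block. -/
lemma effLength_succ_le {Z : Finset ℤ} (s : ℤ) {t t' : ℤ} (h : Finset.Icc t t' ⊆ Z) :
    effLength Z s (t' + 1) ≤ effLength Z s t := by
  refine Finset.card_le_card fun a ha => ?_
  simp only [Finset.mem_sdiff, Finset.mem_Ico] at ha ⊢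
  refine ⟨⟨ha.1.1, ?_⟩, ha.2⟩
  by_contra hcon
  exact ha.2 (h (Finset.mem_Icc.2 ⟨by omega, by omega⟩))

/-- Converts effective length back into distance at the end; the only loss is the size of `Z`. -/
lemma le_effLength_add (Z : Finset ℤ) {s t : ℤ} (h : s ≤ t) :
    (t : ℝ) - s ≤ effLength Z s t + Z.card := by
  have h2 : (Finset.Ico s t).card ≤ effLength Z s t + Z.card := by
    refine (Finset.card_le_card (t := (Finset.Ico s t \ Z) ∪ Z) ?_).trans
      (Finset.card_union_le _ _)
    intro a ha
    by_cases h : a ∈ Z <;> simp_all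
  rw [Int.card_Ico] at h2
  have h3 : ((t - s).toNat : ℝ) = t - s := by
    have : ((t - s).toNat : ℤ) = t - s := Int.toNat_of_nonneg (by omega)
    exact_mod_cast congrArg (Int.cast (R := ℝ)) this
  rw [← h3]
  exact_mod_cast h2

/-- The row `x` can be expanded by means of a region of size `M` with decaying Green's
function, whose entries in this row are at most `B`. -/
def GoodSite (A : Matrix (Fin d → ℤ) (Fin d → ℤ) ℂ) (c σ' : ℝ) (M : ℕ) (B : ℝ)
    (Λ : Finset (Fin d → ℤ)) (x : Fin d → ℤ) : Prop :=
  ∃ W ⊆ Λ, x ∈ W ∧ GreenDecay A c σ' M W ∧ (∀ z ∈ Λ \ W, (M : ℝ) / 2 ≤ ‖x - z‖) ∧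
    ∀ w ∈ W, ‖greenFn A W x w‖ ≤ B

section step

variable {A : Matrix (Fin d → ℤ) (Fin d → ℤ) ℂ} {K c₁ c η σ' : ℝ} {M : ℕ} {B V : ℝ}
  {Λ : Finset (Fin d → ℤ)}

/-- Expansion of a row at a good site. -/
lemma GoodSite.exists_expansion (hA : SubexpDecay A K c₁ σ') (hK : 0 ≤ K) (hσ0 : 0 < σ')
    (hσ1 : σ' ≤ 1) (hc₀ : 0 ≤ c) (hc₁ : 0 ≤ c₁)
    (hc : c ≤ ((5 : ℝ) ^ σ' - 1) / (5 : ℝ) ^ σ' * c₁) (hB : 1 ≤ B) (hV : (Λ.card : ℝ) ≤ V)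
    {x : Fin d → ℤ} (h : GoodSite A c σ' M B Λ x) :
    ∃ W ⊆ Λ, x ∈ W ∧ GreenDecay A c σ' M W ∧ (∀ w ∈ W, ‖greenFn A W x w‖ ≤ B) ∧
      ∀ z ∈ Λ \ W, (M : ℝ) / 2 ≤ ‖x - z‖ ∧
      ‖∑ w ∈ W, greenFn A W x w * A w z‖ ≤ V * B * K * Real.exp (-c * ‖x - z‖ ^ σ') := by
  obtain ⟨W, hW, hx, hG, hd, hb⟩ := h
  refine ⟨W, hW, hx, hG, hb, fun z hz => ⟨hd z hz, ?_⟩⟩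
  exact norm_sum_greenFn_mul_le hA hK hσ0 hσ1 hc₀ hc₁ hc hG hB hb
    (le_trans (by exact_mod_cast Finset.card_le_card hW) hV) hx (hd z hz)

/-- Invertibility on a region all of whose sites are good. -/
lemma isUnit_restrict_of_goodSite (hA : SubexpDecay A K c₁ σ') (hK : 0 ≤ K) (hσ0 : 0 < σ')
    (hσ1 : σ' ≤ 1) (hc₀ : 0 ≤ c) (hc₁ : 0 ≤ c₁)
    (hc : c ≤ ((5 : ℝ) ^ σ' - 1) / (5 : ℝ) ^ σ' * c₁) (hB : 1 ≤ B) (hV : (Λ.card : ℝ) ≤ V)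
    (hsmall : V ^ 2 * B * K * Real.exp (-c * ((M : ℝ) / 2) ^ σ') ≤ 1 / 2)
    (hgood : ∀ x ∈ Λ, GoodSite A c σ' M B Λ x) : IsUnit (restrict A Λ) := by
  refine isUnit_restrict_of_ker fun v hv => ?_
  have hV0 : 0 ≤ V := le_trans (by positivity) hV
  have key : ∀ ε : ℝ, 0 < ε → ∀ x ∈ Λ, ‖v x‖ ≤ ε := by
    intro ε hε
    -- A kernel vector has no source term, so it lies below every positive constant barrier.
    refine le_of_contraction (u := fun x => ‖v x‖) (h := fun _ => ε)
      (fun _ _ => norm_nonneg _) (fun _ _ => hε) fun t ht hvt x hx => ?_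
    obtain ⟨W, hW, hxW, hG, -, hz⟩ :=
      (hgood x hx).exists_expansion hA hK hσ0 hσ1 hc₀ hc₁ hc hB hV
    have h1 := eq_sum_greenFn_sub hG.1 hW v hxW
    have h2 : ∑ w ∈ W, greenFn A W x w * ∑ z ∈ Λ, A w z * v z = 0 :=
      Finset.sum_eq_zero fun w hw => by rw [hv w (hW hw), mul_zero]
    rw [h2, zero_sub] at h1
    have h3 : ‖v x‖ ≤ t / 2 * ε := by
      rw [h1, norm_neg]
      refine (norm_sum_le _ _).trans ?_
      calc ∑ z ∈ Λ \ W, ‖(∑ w ∈ W, greenFn A W x w * A w z) * v z‖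
          ≤ ∑ _z ∈ Λ \ W, V * B * K * Real.exp (-c * ((M : ℝ) / 2) ^ σ') * (t * ε) := by
            refine Finset.sum_le_sum fun z hzz => ?_
            rw [norm_mul]
            have hpw : ((M : ℝ) / 2) ^ σ' ≤ ‖x - z‖ ^ σ' :=
              Real.rpow_le_rpow (by positivity) (hz z hzz).1 hσ0.le
            refine mul_le_mul ((hz z hzz).2.trans ?_) (hvt z (Finset.sdiff_subset hzz))
              (norm_nonneg _) (by positivity)
            gcongr ?_ * Real.exp ?_
            nlinarith
        _ = ((Λ \ W).card : ℝ) *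
            (V * B * K * Real.exp (-c * ((M : ℝ) / 2) ^ σ') * (t * ε)) := by
            rw [Finset.sum_const, nsmul_eq_mul]
        _ ≤ V * (V * B * K * Real.exp (-c * ((M : ℝ) / 2) ^ σ') * (t * ε)) := by
            gcongr
            exact le_trans (by exact_mod_cast Finset.card_le_card Finset.sdiff_subset) hV
        _ = (V ^ 2 * B * K * Real.exp (-c * ((M : ℝ) / 2) ^ σ')) * (t * ε) := by ring
        _ ≤ 1 / 2 * (t * ε) := by gcongr
        _ = _ := by ring
    nlinarith
  intro x hx
  by_contra hne
  have hpos : 0 < ‖v x‖ := norm_pos_iff.2 hne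
  linarith [key (‖v x‖ / 2) (by linarith) x hx]

/-- Decay of the Green's function by the maximum principle.  The function `π` is a coordinate;
`Z` contains the values of `π` that are skipped.  At a bad site the row is expanded by means of
a region `{π ≤ t}` with bounded inverse. -/
theorem norm_greenFn_le_of_expansions (hA : SubexpDecay A K c₁ σ') (hK : 0 ≤ K) (hσ0 : 0 < σ')
    (hσ1 : σ' ≤ 1) (hη : 0 ≤ η) (hηc : η ≤ c) (hc₁ : 0 ≤ c₁)
    (hc : c ≤ ((5 : ℝ) ^ σ' - 1) / (5 : ℝ) ^ σ' * c₁) (hB : 1 ≤ B) (hV : (Λ.card : ℝ) ≤ V)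
    (hU : IsUnit (restrict A Λ)) {π : (Fin d → ℤ) → ℤ}
    (hπ : ∀ x y, |(π x : ℝ) - π y| ≤ ‖x - y‖) {Z : Finset ℤ} {Bad : Set (Fin d → ℤ)}
    {E E₁ : ℝ} (hE₁ : 1 ≤ E₁) (hEE : E ≤ E₁) (hVE : 2 * V ^ 2 * K * E ≤ E₁)
    (hsmall : 2 * V ^ 2 * B * K * E₁ ≤ Real.exp (η * ((M : ℝ) / 2) ^ σ'))
    (hexp : E₁ ≤ Real.exp (η * (M : ℝ) ^ σ'))
    (hgood : ∀ x ∈ Λ, x ∉ Bad → GoodSite A c σ' M B Λ x)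
    (hbad : ∀ x ∈ Λ, x ∈ Bad → ∃ t : ℤ, π x ≤ t ∧ Finset.Icc (π x) t ⊆ Z ∧
      IsUnit (restrict A (Λ.filter fun z => π z ≤ t)) ∧
      opNorm (green A (Λ.filter fun z => π z ≤ t)) ≤ E ∧
      ∀ z ∈ Λ, z ∈ Bad → π z ≤ t ∨ t + M ≤ π z)
    {x₀ y : Fin d → ℤ} (hx₀ : x₀ ∈ Λ) (hy : y ∈ Λ) :
    ‖greenFn A Λ x₀ y‖ ≤ 2 * B * E₁ * Real.exp (c * (M : ℝ) ^ σ') *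
      Real.exp (-(c - η) * (effLength Z (π x₀) (π y) : ℝ) ^ σ') := by
  classical
  have hV0 : 0 ≤ V := le_trans (by positivity) hV
  have hc₀ : 0 ≤ c := hη.trans hηc
  set c' := c - η with hc'
  have hc'0 : 0 ≤ c' := sub_nonneg.2 hηc
  have hcc₁ : c ≤ c₁ := rate_le hc₁ hc
  set ρ : (Fin d → ℤ) → ℝ := fun x => (effLength Z (π x₀) (π x) : ℝ) ^ σ' with hρ
  -- The barrier is higher by the factor `E₁` at bad sites. This room absorbs the norm bound `E` and
  -- the volume factors of an expansion there, which gains no decay of its own.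
  set β : (Fin d → ℤ) → ℝ := fun x => if x ∈ Bad then E₁ else 1 with hβ
  have hβ1 : ∀ x, 1 ≤ β x := fun x => by simp only [hβ]; split_ifs <;> linarith
  have hβE : ∀ x, β x ≤ E₁ := fun x => by simp only [hβ]; split_ifs <;> linarith
  have hρlip : ∀ x z, ρ z ≤ ρ x + ‖x - z‖ ^ σ' := fun x z => by
    refine rpow_le_rpow_add_of_le_add (by positivity) (by positivity) (norm_nonneg _) hσ0.le hσ1
      ((effLength_le_add_abs Z _ (π x) (π z)).trans ?_)
    gcongr
    rw [norm_sub_rev]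
    exact hπ z x
  -- The factor `2 * B` dominates the source term at a good site, and `exp(c M^σ')` covers the
  -- change of `ρ` between `x` and a nearby `y`.
  set H := 2 * B * Real.exp (c * (M : ℝ) ^ σ') with hH
  have hH2 : 2 ≤ H := by
    have : 1 ≤ Real.exp (c * (M : ℝ) ^ σ') := Real.one_le_exp (by positivity)
    nlinarith
  set h : (Fin d → ℤ) → ℝ := fun x => H * β x * Real.exp (c' * (ρ x - ρ y)) with hh
  have hβ0 : ∀ x, 0 < β x := fun x => one_pos.trans_le (hβ1 x)
  have main : ∀ x ∈ Λ, ‖greenFn A Λ x y‖ ≤ h x := by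
    refine le_of_contraction (u := fun x => ‖greenFn A Λ x y‖) (fun _ _ => norm_nonneg _)
      (fun x _ => by have := hβ0 x; positivity) fun t ht hut x hx => ?_
    by_cases hxB : x ∈ Bad
    · obtain ⟨s, hxs, hZ, hUS, hES, hsep⟩ := hbad x hx hxB
      set S := Λ.filter fun z => π z ≤ s with hS
      have hSΛ : S ⊆ Λ := Finset.filter_subset _ _
      have hxS : x ∈ S := Finset.mem_filter.2 ⟨hx, hxs⟩
      have hE0 : 0 ≤ E := (norm_nonneg _).trans hES
      have hskip := effLength_succ_le (π x₀) hZ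
      have hβx : β x = E₁ := if_pos hxB
      have hhx : h x = H * E₁ * Real.exp (c' * (ρ x - ρ y)) := by simp only [hh, hβx]
      rw [greenFn_resolvent hUS hU hSΛ hxS hy]
      -- If `y` lies below the face of the half-space, its effective length is at most that of `x`,
      -- because the layer from `π x` to `s` is skipped.
      have hsrc : ‖greenFn A S x y‖ ≤ 1 / 2 * h x := by
        by_cases hyS : y ∈ S
        · have h1 : ρ y ≤ ρ x := by
            refine Real.rpow_le_rpow (by positivity) ?_ hσ0.le
            exact_mod_cast (effLength_mono Z _ (by
              have := (Finset.mem_filter.1 hyS).2; omega)).trans hskip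
          have h2 : 1 ≤ Real.exp (c' * (ρ x - ρ y)) :=
            Real.one_le_exp (mul_nonneg hc'0 (by linarith))
          calc ‖greenFn A S x y‖ ≤ E := (norm_greenFn_le_opNorm _ _ _ _).trans hES
            _ ≤ E₁ := hEE
            _ = 1 / 2 * (2 * E₁ * 1) := by ring
            _ ≤ 1 / 2 * (H * E₁ * Real.exp (c' * (ρ x - ρ y))) := by gcongr
            _ = _ := by rw [hhx]
        · rw [greenFn_of_not_mem_right A hyS, norm_zero, hhx]
          positivity
      have hterm : ∀ z ∈ Λ \ S, ∀ w ∈ S,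
          ‖A w z‖ * (t * h z) ≤ K * t * H * Real.exp (c' * (ρ x - ρ y)) := by
        intro z hz w hw
        have hzΛ := (Finset.mem_sdiff.1 hz).1
        have hzs : s < π z := by
          by_contra hcon
          exact (Finset.mem_sdiff.1 hz).2 (Finset.mem_filter.2 ⟨hzΛ, by omega⟩)
        have hws := (Finset.mem_filter.1 hw).2
        have hwz : (π z : ℝ) - π w ≤ ‖w - z‖ := by
          rw [norm_sub_rev]; exact (le_abs_self _).trans (hπ z w)
        have hsR : (π w : ℝ) ≤ s := by exact_mod_cast hws
        -- The barrier at `z` is compared with that at `x`, although the jump of `A` starts at `w`: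
        -- the effective length grows only beyond `s`, and `w` lies on or below that level.
        have hρz : ρ z ≤ ρ x + ‖w - z‖ ^ σ' := by
          refine rpow_le_rpow_add_of_le_add (by positivity) (by positivity) (norm_nonneg _)
            hσ0.le hσ1 ?_
          have h1 := effLength_le_add Z (π x₀) (show s + 1 ≤ π z by omega)
          have h2 : (effLength Z (π x₀) (s + 1) : ℝ) ≤ effLength Z (π x₀) (π x) := by
            exact_mod_cast hskip
          push_cast at h1
          linarith
        -- A bad site above the face is at least `M` away from it, so the jump is long enough for
        -- the loss `η` in the rate to pay for the weight `E₁`.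
        have hβz : β z ≤ Real.exp (η * ‖w - z‖ ^ σ') := by
          by_cases hzB : z ∈ Bad
          · have h1 : (M : ℝ) ≤ ‖w - z‖ := by
              have h2 : s + M ≤ π z := (hsep z hzΛ hzB).resolve_left (by omega)
              have h3 : (s : ℝ) + M ≤ π z := by exact_mod_cast h2
              linarith
            refine (hβE z).trans (hexp.trans (Real.exp_le_exp.2 ?_))
            gcongr
          · simp only [hβ, if_neg hzB]
            exact Real.one_le_exp (by positivity)
        calc ‖A w z‖ * (t * h z)
            ≤ K * Real.exp (-c₁ * ‖w - z‖ ^ σ') * (t * (H * Real.exp (η * ‖w - z‖ ^ σ') *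
                Real.exp (c' * (ρ x - ρ y) + c' * ‖w - z‖ ^ σ'))) := by
              simp only [hh]
              gcongr
              · exact hA w z
              · nlinarith
          _ = K * t * H * Real.exp (-c₁ * ‖w - z‖ ^ σ' + η * ‖w - z‖ ^ σ' +
                (c' * (ρ x - ρ y) + c' * ‖w - z‖ ^ σ')) := by
              simp only [Real.exp_add]; ring
          _ ≤ _ := by
              gcongr
              have : 0 ≤ (c₁ - c) * ‖w - z‖ ^ σ' :=
                mul_nonneg (by linarith) (by positivity)
              simp only [hc']
              linarith
      have hsum : ‖∑ z ∈ Λ \ S, (∑ w ∈ S, greenFn A S x w * A w z) * greenFn A Λ z y‖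
          ≤ t / 2 * h x := by
        refine (norm_sum_le _ _).trans ?_
        calc ∑ z ∈ Λ \ S, ‖(∑ w ∈ S, greenFn A S x w * A w z) * greenFn A Λ z y‖
            ≤ ∑ _z ∈ Λ \ S, V * (E * (K * t * H * Real.exp (c' * (ρ x - ρ y)))) := by
              refine Finset.sum_le_sum fun z hz => ?_
              rw [Finset.sum_mul]
              refine (norm_sum_le _ _).trans ?_
              calc ∑ w ∈ S, ‖greenFn A S x w * A w z * greenFn A Λ z y‖
                  ≤ ∑ _w ∈ S, E * (K * t * H * Real.exp (c' * (ρ x - ρ y))) := by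
                    refine Finset.sum_le_sum fun w hw => ?_
                    rw [norm_mul, norm_mul, mul_assoc]
                    refine mul_le_mul ((norm_greenFn_le_opNorm _ _ _ _).trans hES) ?_
                      (by positivity) hE0
                    exact (mul_le_mul_of_nonneg_left (hut z (Finset.mem_sdiff.1 hz).1)
                      (norm_nonneg _)).trans (hterm z hz w hw)
                _ = (S.card : ℝ) * _ := by rw [Finset.sum_const, nsmul_eq_mul]
                _ ≤ V * _ := by
                  gcongr
                  exact le_trans (by exact_mod_cast Finset.card_le_card hSΛ) hV
          _ = ((Λ \ S).card : ℝ) * _ := by rw [Finset.sum_const, nsmul_eq_mul]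
          _ ≤ V * (V * (E * (K * t * H * Real.exp (c' * (ρ x - ρ y))))) := by
            gcongr
            exact le_trans (by exact_mod_cast Finset.card_le_card Finset.sdiff_subset) hV
          _ = t / 2 * (H * (2 * V ^ 2 * K * E) * Real.exp (c' * (ρ x - ρ y))) := by ring
          _ ≤ t / 2 * (H * E₁ * Real.exp (c' * (ρ x - ρ y))) := by gcongr
          _ = _ := by rw [hhx]
      calc _ ≤ _ := norm_sub_le _ _
        _ ≤ _ := add_le_add hsrc hsum
        _ = _ := by ring
    · obtain ⟨W, hW, hxW, hG, hb, hz⟩ :=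
        (hgood x hx hxB).exists_expansion hA hK hσ0 hσ1 hc₀ hc₁ hc hB hV
      have hβx : β x = 1 := if_neg hxB
      have hhx : h x = H * Real.exp (c' * (ρ x - ρ y)) := by simp only [hh, hβx, mul_one]
      rw [greenFn_resolvent hG.1 hU hW hxW hy]
      have hsrc : ‖greenFn A W x y‖ ≤ 1 / 2 * h x := by
        by_cases hyW : y ∈ W
        · have h1 := hρlip x y
          rcases lt_or_ge ‖x - y‖ ((M : ℝ) / 10) with h2 | h2
          · have h3 : ‖x - y‖ ^ σ' ≤ (M : ℝ) ^ σ' :=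
              Real.rpow_le_rpow (norm_nonneg _) (by linarith [Nat.cast_nonneg (α := ℝ) M])
                hσ0.le
            have h0 : 0 ≤ (M : ℝ) ^ σ' := by positivity
            calc ‖greenFn A W x y‖ ≤ B := hb y hyW
              _ = 1 / 2 * (2 * B * 1) := by ring
              _ ≤ 1 / 2 * (2 * B * Real.exp (c * (M : ℝ) ^ σ' + c' * (ρ x - ρ y))) := by
                gcongr
                refine Real.one_le_exp ?_
                have h4 : c' * (ρ y - ρ x) ≤ c' * (M : ℝ) ^ σ' := by gcongr; linarith
                have h5 : c' * (M : ℝ) ^ σ' ≤ c * (M : ℝ) ^ σ' := by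
                  gcongr; simp only [hc']; linarith
                linarith
              _ = _ := by rw [hhx, Real.exp_add, hH]; ring
          · calc ‖greenFn A W x y‖ ≤ Real.exp (-c * ‖x - y‖ ^ σ') :=
                  (greenDecay_iff.1 hG).2 x hxW y hyW h2
              _ = 1 / 2 * (2 * Real.exp (-c * ‖x - y‖ ^ σ')) := by ring
              _ ≤ 1 / 2 * (H * Real.exp (c' * (ρ x - ρ y))) := by
                gcongr ?_ * (?_ * Real.exp ?_)
                have h4 : c' * (ρ y - ρ x) ≤ c' * ‖x - y‖ ^ σ' := by gcongr; linarith
                have h5 : c' * ‖x - y‖ ^ σ' ≤ c * ‖x - y‖ ^ σ' := by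
                  gcongr; simp only [hc']; linarith
                linarith
              _ = _ := by rw [hhx]
        · rw [greenFn_of_not_mem_right A hyW, norm_zero, hhx]
          positivity
      have hsum : ‖∑ z ∈ Λ \ W, (∑ w ∈ W, greenFn A W x w * A w z) * greenFn A Λ z y‖
          ≤ t / 2 * h x := by
        refine (norm_sum_le _ _).trans ?_
        -- Since the barrier grows at rate `c - η` while the coefficients decay at rate `c`, each
        -- jump of length at least `M/2` gains the factor `q`.
        set q := Real.exp (-η * ((M : ℝ) / 2) ^ σ') with hq
        have hqs : 2 * V ^ 2 * B * K * E₁ * q ≤ 1 := by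
          calc 2 * V ^ 2 * B * K * E₁ * q ≤ Real.exp (η * ((M : ℝ) / 2) ^ σ') * q := by gcongr
            _ = 1 := by rw [hq, ← Real.exp_add]; simp
        calc ∑ z ∈ Λ \ W, ‖(∑ w ∈ W, greenFn A W x w * A w z) * greenFn A Λ z y‖
            ≤ ∑ _z ∈ Λ \ W, V * B * K * E₁ * q * t * h x := by
              refine Finset.sum_le_sum fun z hzz => ?_
              rw [norm_mul]
              obtain ⟨hz1, hz2⟩ := hz z hzz
              have hpw : ((M : ℝ) / 2) ^ σ' ≤ ‖x - z‖ ^ σ' :=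
                Real.rpow_le_rpow (by positivity) hz1 hσ0.le
              have h1 := hρlip x z
              calc ‖∑ w ∈ W, greenFn A W x w * A w z‖ * ‖greenFn A Λ z y‖
                  ≤ V * B * K * Real.exp (-c * ‖x - z‖ ^ σ') * (t * (H * E₁ *
                    Real.exp (c' * (ρ x - ρ y) + c' * ‖x - z‖ ^ σ'))) := by
                    refine mul_le_mul hz2 ((hut z (Finset.mem_sdiff.1 hzz).1).trans ?_)
                      (norm_nonneg _) (by positivity)
                    simp only [hh]
                    gcongr
                    · exact hβE z
                    · nlinarith
                _ = V * B * K * E₁ * t * H * (Real.exp (-c * ‖x - z‖ ^ σ' +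
                    (c' * (ρ x - ρ y) + c' * ‖x - z‖ ^ σ'))) := by
                    rw [Real.exp_add (-c * ‖x - z‖ ^ σ')]; ring
                _ ≤ V * B * K * E₁ * t * H *
                    Real.exp (-η * ((M : ℝ) / 2) ^ σ' + c' * (ρ x - ρ y)) := by
                    have h0 : 0 ≤ V * B * K * E₁ * t * H := by positivity
                    refine mul_le_mul_of_nonneg_left (Real.exp_le_exp.2 ?_) h0
                    have h5 : η * ((M : ℝ) / 2) ^ σ' ≤ η * ‖x - z‖ ^ σ' := by gcongr
                    have h6 : c * ‖x - z‖ ^ σ' = c' * ‖x - z‖ ^ σ' + η * ‖x - z‖ ^ σ' := by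
                      rw [hc']; ring
                    linarith
                _ = _ := by rw [Real.exp_add, hhx, hq]; ring
          _ = ((Λ \ W).card : ℝ) * (V * B * K * E₁ * q * t * h x) := by
              rw [Finset.sum_const, nsmul_eq_mul]
          _ ≤ V * (V * B * K * E₁ * q * t * h x) := by
              have : 0 ≤ h x := by rw [hhx]; positivity
              gcongr
              exact le_trans (by exact_mod_cast Finset.card_le_card Finset.sdiff_subset) hV
          _ = t / 2 * (2 * V ^ 2 * B * K * E₁ * q) * h x := by ring
          _ ≤ t / 2 * 1 * h x := by
              have : 0 ≤ h x := by rw [hhx]; positivity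
              gcongr
          _ = _ := by ring
      calc _ ≤ _ := norm_sub_le _ _
        _ ≤ _ := add_le_add hsrc hsum
        _ = _ := by ring
  refine (main x₀ hx₀).trans ?_
  have h0 : ρ x₀ = 0 := by
    simp only [hρ, effLength_self, Nat.cast_zero]
    exact Real.zero_rpow hσ0.ne'
  simp only [hh, h0, zero_sub]
  calc H * β x₀ * Real.exp (c' * -ρ y) ≤ H * E₁ * Real.exp (c' * -ρ y) := by
        gcongr; exact hβE x₀
    _ = _ := by rw [hH, mul_neg, neg_mul]; ring

end step

end MSA

/-! ### Boxes with a cut-out corner and their width -/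

namespace MSA

variable {d : ℕ}

/-- The set cut out of a box at the corner `c`; nothing is cut out if all signs vanish. -/
def IsCut (ς : Fin d → SignType) (c n : Fin d → ℤ) : Prop :=
  ς ≠ 0 ∧ ∀ i, (ς i = SignType.neg → n i < c i) ∧ (ς i = SignType.pos → c i < n i)

open Classical in
/-- The box `[a, b]` without the sites that are cut out at the corner `c`. -/
noncomputable def cutBox (a b : Fin d → ℤ) (ς : Fin d → SignType) (c : Fin d → ℤ) :
    Finset (Fin d → ℤ) :=
  (Fintype.piFinset fun i => Finset.Icc (a i) (b i)).filter fun n => ¬ IsCut ς c n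

lemma mem_cutBox {a b : Fin d → ℤ} {ς : Fin d → SignType} {c n : Fin d → ℤ} :
    n ∈ cutBox a b ς c ↔ (∀ i, a i ≤ n i ∧ n i ≤ b i) ∧ ¬ IsCut ς c n := by
  simp [cutBox]

/-- The signs of an elementary region: none, or at least two. -/
def AdmissibleSigns (ς : Fin d → SignType) : Prop :=
  ς = 0 ∨ ∃ i j, i ≠ j ∧ ς i ≠ 0 ∧ ς j ≠ 0

lemma mem_elementaryRegions_iff {Λ : Finset (Fin d → ℤ)} {N : ℕ} :
    Λ ∈ elementaryRegions d N ↔ ∃ c ς, AdmissibleSigns ς ∧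
      Λ = cutBox (fun i => c i - N) (fun i => c i + N) ς c := by
  have himage : ∀ (Q : Finset (Fin d → ℤ)) (c n : Fin d → ℤ),
      n ∈ Q.image (fun m => c + m) ↔ n - c ∈ Q := by
    intro Q c n
    simp only [Finset.mem_image]
    constructor
    · rintro ⟨m, hm, rfl⟩; simpa using hm
    · intro h; exact ⟨n - c, h, by simp⟩
  have hcube : ∀ c : Fin d → ℤ, (cube d N).image (fun m => c + m)
      = cutBox (fun i => c i - N) (fun i => c i + N) 0 c := by
    intro c
    ext n
    rw [himage, mem_cutBox]
    simp only [cube, Fintype.mem_piFinset, Finset.mem_Icc, Pi.sub_apply, IsCut, ne_eq,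
      not_true_eq_false, false_and, not_false_eq_true, and_true]
    exact forall_congr' fun i => ⟨fun h => ⟨by omega, by omega⟩, fun h => ⟨by omega, by omega⟩⟩
  have hcut : ∀ (c : Fin d → ℤ) (ς : Fin d → SignType), ς ≠ 0 →
      (cutCube d N ς).image (fun m => c + m)
      = cutBox (fun i => c i - N) (fun i => c i + N) ς c := by
    intro c ς hς
    ext n
    rw [himage, mem_cutBox]
    simp only [cutCube, cube, Finset.mem_filter, Fintype.mem_piFinset, Finset.mem_Icc,
      Pi.sub_apply, IsCut, ne_eq, hς, not_false_eq_true, true_and, sub_neg, sub_pos]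
    refine and_congr_left fun _ => ?_
    exact forall_congr' fun i => ⟨fun h => ⟨by omega, by omega⟩, fun h => ⟨by omega, by omega⟩⟩
  have hne : ∀ ς : Fin d → SignType, (∃ i j, i ≠ j ∧ ς i ≠ 0 ∧ ς j ≠ 0) → ς ≠ 0 := by
    rintro ς ⟨i, -, -, hi, -⟩ rfl
    exact hi rfl
  constructor
  · rintro ⟨c, Q, rfl | ⟨ς, hς, rfl⟩, rfl⟩
    · exact ⟨c, 0, Or.inl rfl, hcube c⟩
    · exact ⟨c, ς, Or.inr hς, hcut c ς (hne ς hς)⟩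
  · rintro ⟨c, ς, rfl | hς, rfl⟩
    · exact ⟨c, _, Or.inl rfl, (hcube c).symm⟩
    · exact ⟨c, _, Or.inr ⟨ς, hς, rfl⟩, (hcut c ς (hne ς hς)).symm⟩

/-- The doubled integer form makes the distance condition independent of the parity of `M` and
accessible to integer arithmetic. -/
lemma half_le_norm_sub {n m : Fin d → ℤ} {M : ℕ} (i : Fin d)
    (h : (M : ℤ) ≤ 2 * (n i - m i) ∨ (M : ℤ) ≤ 2 * (m i - n i)) : (M : ℝ) / 2 ≤ ‖n - m‖ := by
  refine le_trans ?_ (norm_le_pi_norm (n - m) i)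
  rw [Pi.sub_apply, Int.norm_eq_abs]
  push_cast
  rcases h with h | h
  · have : (M : ℝ) ≤ 2 * (n i - m i) := by exact_mod_cast h
    linarith [le_abs_self ((n i : ℝ) - m i)]
  · have : (M : ℝ) ≤ 2 * (m i - n i) := by exact_mod_cast h
    linarith [neg_le_abs ((n i : ℝ) - m i)]

/-- A cube in a box which contains a given point and whose relative boundary is far from it. -/
lemma exists_cube_center {a b n : Fin d → ℤ} {M : ℕ} (hab : ∀ i, a i + 2 * M ≤ b i)
    (hn : ∀ i, a i ≤ n i ∧ n i ≤ b i) :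
    ∃ w : Fin d → ℤ, (∀ i, a i ≤ w i - M ∧ w i + M ≤ b i) ∧
      (∀ i, w i - M ≤ n i ∧ n i ≤ w i + M) ∧
      ∀ (i : Fin d) (t : ℤ), a i ≤ t → t ≤ b i → (t < w i - M ∨ w i + M < t) →
        (M : ℤ) ≤ 2 * (n i - t) ∨ (M : ℤ) ≤ 2 * (t - n i) := by
  -- The center is `n` pushed into the box. Where it had to be moved, the face of the cube coincides
  -- with the nearby face of the box, so no site of the box lies beyond it.
  refine ⟨fun i => max (a i + M) (min (n i) (b i - M)), fun i => ?_, fun i => ?_,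
    fun i t h1 h2 h3 => ?_⟩
  · have := hab i; beta_reduce; omega
  · have := hab i; have := hn i; beta_reduce; omega
  · have := hab i; have := hn i; beta_reduce at h3; omega

lemma cube_mem_elementaryRegions (w : Fin d → ℤ) (M : ℕ) :
    cutBox (fun i => w i - M) (fun i => w i + M) 0 w ∈ elementaryRegions d M :=
  mem_elementaryRegions_iff.2 ⟨w, 0, Or.inl rfl, rfl⟩

lemma not_isCut_zero (c n : Fin d → ℤ) : ¬ IsCut 0 c n := fun h => h.1 rfl

/-- The condition on the width at `n`, when `n` lies in a wide box without cut-out sites. -/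
lemma exists_elementaryRegion_of_box {a b a' b' c n : Fin d → ℤ} {ς : Fin d → SignType} {M : ℕ}
    (haa : ∀ i, a i ≤ a' i) (hbb : ∀ i, b' i ≤ b i) (hab : ∀ i, a' i + 2 * M ≤ b' i)
    (hn : ∀ i, a' i ≤ n i ∧ n i ≤ b' i)
    (hcut : ∀ m : Fin d → ℤ, (∀ i, a' i ≤ m i ∧ m i ≤ b' i) → ¬ IsCut ς c m)
    (hfar : ∀ m ∈ cutBox a b ς c, ∀ i, (m i < a' i ∨ b' i < m i) →
      ∃ j, (M : ℤ) ≤ 2 * (n j - m j) ∨ (M : ℤ) ≤ 2 * (m j - n j)) :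
    ∃ W ∈ elementaryRegions d M, n ∈ W ∧ W ⊆ cutBox a b ς c ∧
      ∀ m ∈ cutBox a b ς c \ W, (M : ℝ) / 2 ≤ ‖n - m‖ := by
  obtain ⟨w, hw1, hw2, hw3⟩ := exists_cube_center hab hn
  refine ⟨_, cube_mem_elementaryRegions w M, mem_cutBox.2 ⟨hw2, not_isCut_zero _ _⟩, ?_, ?_⟩
  · intro m hm
    have hm' := (mem_cutBox.1 hm).1
    refine mem_cutBox.2 ⟨fun i => ?_, hcut m fun i => ?_⟩
    · have := hm' i; have := hw1 i; have := haa i; have := hbb i; omega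
    · have := hm' i; have := hw1 i; omega
  · intro m hm
    rw [Finset.mem_sdiff] at hm
    obtain ⟨i, hi⟩ : ∃ i, m i < w i - M ∨ w i + M < m i := by
      by_contra! hcon
      exact hm.2 (mem_cutBox.2 ⟨hcon, not_isCut_zero _ _⟩)
    by_cases h : a' i ≤ m i ∧ m i ≤ b' i
    · exact half_le_norm_sub i (hw3 i (m i) h.1 h.2 hi)
    · obtain ⟨j, hj⟩ := hfar m hm.1 i (by omega)
      exact half_le_norm_sub j hj

lemma signType_cases (s : SignType) : s = 0 ∨ s = SignType.neg ∨ s = SignType.pos := by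
  cases s
  · exact Or.inl rfl
  · exact Or.inr (Or.inl rfl)
  · exact Or.inr (Or.inr rfl)

/-- A box with a cut-out corner is wide if its sides are long and the corner is far from the
faces of the box. -/
theorem widthCondition_cutBox {a b c : Fin d → ℤ} {ς : Fin d → SignType} {M : ℕ}
    (hab : ∀ i, a i + 2 * M ≤ b i)
    (hc : ∀ i, ς i ≠ 0 → a i + 2 * M + 1 ≤ c i ∧ c i + 2 * M + 1 ≤ b i) :
    WidthCondition (cutBox a b ς c) M := by
  classical
  intro n hn
  obtain ⟨hnb, hnc⟩ := mem_cutBox.1 hn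
  by_cases hς : ς = 0
  · refine exists_elementaryRegion_of_box (fun i => le_rfl) (fun i => le_rfl) hab hnb
      (fun m _ => hς ▸ not_isCut_zero _ _) fun m hm i hi => ?_
    have := (mem_cutBox.1 hm).1 i
    omega
  have hp0 : (SignType.pos : SignType) ≠ 0 := by decide
  have hn0 : (SignType.neg : SignType) ≠ 0 := by decide
  have hpn : (SignType.pos : SignType) ≠ SignType.neg := by decide
  -- If `n` is more than `M/2` inside the allowed side of some signed coordinate, the part of the
  -- box on that side is uncut and its inner face is far from `n`.
  by_cases hB : ∃ i, (ς i = SignType.pos ∧ 2 * n i + M < 2 * c i) ∨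
      (ς i = SignType.neg ∧ 2 * c i + M < 2 * n i)
  · obtain ⟨i, ⟨hi, hni⟩ | ⟨hi, hni⟩⟩ := hB
    · have hci := hc i (hi ▸ hp0)
      refine exists_elementaryRegion_of_box (a' := a) (b' := Function.update b i (c i))
        (fun k => le_rfl) (fun k => ?_) (fun k => ?_) (fun k => ?_) (fun m hm hcut => ?_)
        fun m hm k hk => ⟨i, ?_⟩
      · by_cases hk : k = i
        · subst hk; simp only [Function.update_self]; omega
        · simp [hk]
      · by_cases hk : k = i
        · subst hk; simp only [Function.update_self]; omega
        · simp only [Function.update_of_ne hk]; exact hab k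
      · by_cases hk : k = i
        · subst hk; simp only [Function.update_self]; have := hnb k; omega
        · simp only [Function.update_of_ne hk]; exact hnb k
      · have h1 := (hm i).2
        have h2 := (hcut.2 i).2 hi
        simp only [Function.update_self] at h1
        omega
      · have h1 := (mem_cutBox.1 hm).1 k
        by_cases hki : k = i
        · subst hki; simp only [Function.update_self] at hk; omega
        · simp only [Function.update_of_ne hki] at hk; omega
    · have hci := hc i (hi ▸ hn0)
      refine exists_elementaryRegion_of_box (a' := Function.update a i (c i)) (b' := b)
        (fun k => ?_) (fun k => le_rfl) (fun k => ?_) (fun k => ?_) (fun m hm hcut => ?_)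
        fun m hm k hk => ⟨i, ?_⟩
      · by_cases hk : k = i
        · subst hk; simp only [Function.update_self]; omega
        · simp [hk]
      · by_cases hk : k = i
        · subst hk; simp only [Function.update_self]; omega
        · simp only [Function.update_of_ne hk]; exact hab k
      · by_cases hk : k = i
        · subst hk; simp only [Function.update_self]; have := hnb k; omega
        · simp only [Function.update_of_ne hk]; exact hnb k
      · have h1 := (hm i).1
        have h2 := (hcut.2 i).1 hi
        simp only [Function.update_self] at h1
        omega
      · have h1 := (mem_cutBox.1 hm).1 k
        by_cases hki : k = i
        · subst hki; simp only [Function.update_self] at hk; omega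
        · simp only [Function.update_of_ne hki] at hk; omega
  have hpos : ∀ i, ς i = SignType.pos → 2 * c i ≤ 2 * n i + M := fun i hi => by
    by_contra hcon; exact hB ⟨i, Or.inl ⟨hi, by omega⟩⟩
  have hneg : ∀ i, ς i = SignType.neg → 2 * n i ≤ 2 * c i + M := fun i hi => by
    by_contra hcon; exact hB ⟨i, Or.inr ⟨hi, by omega⟩⟩
  -- Now `n` survives the cut only through coordinates `j` in which it is on the allowed side but
  -- within `M/2` of the corner.
  obtain ⟨j, hj⟩ : ∃ j, (ς j = SignType.pos ∧ n j ≤ c j) ∨ (ς j = SignType.neg ∧ c j ≤ n j) := by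
    by_contra! hcon
    exact hnc ⟨hς, fun i => ⟨fun h => (hcon i).2 h, fun h => (hcon i).1 h⟩⟩
  set I : Fin d → Prop := fun i => ς i ≠ 0 ∧ 2 * n i ≤ 2 * c i + M ∧ 2 * c i ≤ 2 * n i + M
    with hI
  have hIj : I j := by
    rcases hj with ⟨h, h'⟩ | ⟨h, h'⟩
    · exact ⟨h ▸ hp0, by omega, hpos j h⟩
    · exact ⟨h ▸ hn0, hneg j h, by omega⟩
  have hIpos : ∀ i, ς i = SignType.pos → ¬ I i → 2 * c i + M < 2 * n i := fun i hi hIi => by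
    by_contra hcon; exact hIi ⟨hi ▸ hp0, by omega, hpos i hi⟩
  have hIneg : ∀ i, ς i = SignType.neg → ¬ I i → 2 * n i + M < 2 * c i := fun i hi hIi => by
    by_contra hcon; exact hIi ⟨hi ▸ hn0, hneg i hi, by omega⟩
  by_cases hk : ∃ k, k ≠ j ∧ I k
  · obtain ⟨k, hkj, hIk⟩ := hk
    -- At least two signed coordinates of `n` are near the corner, so a cut cube is admissible.
    -- Sides of length exactly `2 * M` in these coordinates force its center to agree there with
    -- `c`. In the other signed coordinates the cube stays on the removed side, where their
    -- conditions hold automatically.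
    set α : Fin d → ℤ := fun i => if I i then c i - M else if ς i = SignType.pos then c i + 1
      else a i with hα
    set β : Fin d → ℤ := fun i => if I i then c i + M else if ς i = SignType.neg then c i - 1
      else b i with hβ
    have hcases : ∀ i, (I i ∧ α i = c i - M ∧ β i = c i + M) ∨
        (¬ I i ∧ ς i = 0 ∧ α i = a i ∧ β i = b i) ∨
        (¬ I i ∧ ς i = SignType.pos ∧ α i = c i + 1 ∧ β i = b i) ∨
        (¬ I i ∧ ς i = SignType.neg ∧ α i = a i ∧ β i = c i - 1) := by
      intro i
      by_cases h : I i
      · exact Or.inl ⟨h, by simp [hα, h], by simp [hβ, h]⟩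
      · rcases signType_cases (ς i) with h2 | h2 | h2
        · exact Or.inr (Or.inl ⟨h, h2, by simp [hα, h, h2], by simp [hβ, h, h2]⟩)
        · exact Or.inr (Or.inr (Or.inr ⟨h, h2, by simp [hα, h, h2],
            by simp [hβ, h, h2]⟩))
        · exact Or.inr (Or.inr (Or.inl ⟨h, h2, by simp [hα, h, h2],
            by simp [hβ, h, h2]⟩))
    obtain ⟨w, hw1, hw2, hw3⟩ := exists_cube_center (a := α) (b := β) (n := n) (M := M)
      (fun i => by
        rcases hcases i with ⟨h, h1, h2⟩ | ⟨h, h0, h1, h2⟩ | ⟨h, h0, h1, h2⟩ | ⟨h, h0, h1, h2⟩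
        · omega
        · have := hab i; omega
        · have := hc i (h0 ▸ hp0); omega
        · have := hc i (h0 ▸ hn0); omega)
      (fun i => by
        have := hnb i
        rcases hcases i with ⟨h, h1, h2⟩ | ⟨h, h0, h1, h2⟩ | ⟨h, h0, h1, h2⟩ | ⟨h, h0, h1, h2⟩
        · obtain ⟨-, h3, h4⟩ := h; omega
        · omega
        · have := hIpos i h0 h; omega
        · have := hIneg i h0 h; omega)
    have hwI : ∀ i, I i → w i = c i := fun i hi => by
      have := hw1 i
      rcases hcases i with ⟨h, h1, h2⟩ | ⟨h, -⟩ | ⟨h, -⟩ | ⟨h, -⟩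
      · omega
      all_goals exact absurd hi h
    set ς' : Fin d → SignType := fun i => if I i then ς i else 0 with hς'
    have hςI : ∀ i, I i → ς' i = ς i := fun i hi => by simp [hς', hi]
    have hςn : ∀ i, ¬ I i → ς' i = 0 := fun i hi => by simp [hς', hi]
    have hς'0 : ς' ≠ 0 := fun h => hIj.1 (by rw [← hςI j hIj, h]; rfl)
    refine ⟨_, mem_elementaryRegions_iff.2 ⟨w, ς', Or.inr ⟨k, j, hkj, ?_, ?_⟩, rfl⟩,
      mem_cutBox.2 ⟨hw2, ?_⟩, ?_, ?_⟩
    · rw [hςI k hIk]; exact hIk.1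
    · rw [hςI j hIj]; exact hIj.1
    · intro hcut
      have h1 := hcut.2 j
      rw [hςI j hIj, hwI j hIj] at h1
      rcases hj with ⟨h, h'⟩ | ⟨h, h'⟩
      · have := h1.2 h; omega
      · have := h1.1 h; omega
    · intro m hm
      obtain ⟨hm1, hm2⟩ := mem_cutBox.1 hm
      refine mem_cutBox.2 ⟨fun i => ?_, fun hcut => hm2 ⟨hς'0, fun i => ?_⟩⟩
      · have := hm1 i
        have := hw1 i
        rcases hcases i with ⟨h, h1, h2⟩ | ⟨h, h0, h1, h2⟩ | ⟨h, h0, h1, h2⟩ | ⟨h, h0, h1, h2⟩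
        · have := hc i h.1; omega
        · omega
        · have := hc i (h0 ▸ hp0); omega
        · have := hc i (h0 ▸ hn0); omega
      · by_cases hi : I i
        · rw [hςI i hi, hwI i hi]; exact hcut.2 i
        · rw [hςn i hi]; exact ⟨fun h => absurd h.symm hn0, fun h => absurd h.symm hp0⟩
    · intro m hm
      obtain ⟨hm1, hm2⟩ := Finset.mem_sdiff.1 hm
      obtain ⟨hm3, hm4⟩ := mem_cutBox.1 hm1
      obtain ⟨i, hi⟩ : ∃ i, m i < w i - M ∨ w i + M < m i := by
        by_contra! hcon
        refine hm2 (mem_cutBox.2 ⟨hcon, fun hcut => hm4 ⟨hς, fun i => ?_⟩⟩)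
        have h3 := hcon i
        have h4 := hw1 i
        rcases hcases i with ⟨h, h1, h2⟩ | ⟨h, h0, h1, h2⟩ | ⟨h, h0, h1, h2⟩ | ⟨h, h0, h1, h2⟩
        · have := hcut.2 i
          rwa [hςI i h, hwI i h] at this
        · rw [h0]; exact ⟨fun h => absurd h.symm hn0, fun h => absurd h.symm hp0⟩
        · rw [h0]; exact ⟨fun h => absurd h hpn, fun _ => by omega⟩
        · rw [h0]; exact ⟨fun _ => by omega, fun h => absurd h.symm hpn⟩
      refine half_le_norm_sub i ?_
      have h3 := hm3 i
      have h4 := hw3 i (m i)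
      rcases hcases i with ⟨h, h1, h2⟩ | ⟨h, h0, h1, h2⟩ | ⟨h, h0, h1, h2⟩ | ⟨h, h0, h1, h2⟩
      · have := hwI i h
        obtain ⟨-, h5, h6⟩ := h
        omega
      · omega
      · have := hIpos i h0 h; omega
      · have := hIneg i h0 h; omega
  · push Not at hk
    -- Only the coordinate `j` is near the corner, so around `n` the region looks like a half-space
    -- with face at `c j`, and an uncut cube suffices. A site close to `n` beyond this face
    -- satisfies the other cut conditions too and hence is removed from the region.
    set α : Fin d → ℤ := fun i => if i = j then (if ς j = SignType.pos then a j else c j)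
      else if ς i = SignType.pos then c i + 1 else a i with hα
    set β : Fin d → ℤ := fun i => if i = j then (if ς j = SignType.pos then c j else b j)
      else if ς i = SignType.neg then c i - 1 else b i with hβ
    have hcj := hc j hIj.1
    have hjj : (ς j = SignType.pos ∧ n j ≤ c j ∧ α j = a j ∧ β j = c j) ∨
        (ς j = SignType.neg ∧ c j ≤ n j ∧ α j = c j ∧ β j = b j) := by
      rcases hj with ⟨h, h'⟩ | ⟨h, h'⟩
      · exact Or.inl ⟨h, h', by simp [hα, h], by simp [hβ, h]⟩
      · exact Or.inr ⟨h, h', by simp [hα, h], by simp [hβ, h]⟩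
    have hcases : ∀ i, i ≠ j → (ς i = 0 ∧ α i = a i ∧ β i = b i) ∨
        (ς i = SignType.pos ∧ α i = c i + 1 ∧ β i = b i ∧ 2 * c i + M < 2 * n i) ∨
        (ς i = SignType.neg ∧ α i = a i ∧ β i = c i - 1 ∧ 2 * n i + M < 2 * c i) := by
      intro i hij
      rcases signType_cases (ς i) with h2 | h2 | h2
      · exact Or.inl ⟨h2, by simp [hα, hij, h2], by simp [hβ, hij, h2]⟩
      · exact Or.inr (Or.inr ⟨h2, by simp [hα, hij, h2], by simp [hβ, hij, h2],
          hIneg i h2 (hk i hij)⟩)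
      · exact Or.inr (Or.inl ⟨h2, by simp [hα, hij, h2], by simp [hβ, hij, h2],
          hIpos i h2 (hk i hij)⟩)
    refine exists_elementaryRegion_of_box (a' := α) (b' := β) (fun i => ?_) (fun i => ?_)
      (fun i => ?_) (fun i => ?_) (fun m hm hcut => ?_) fun m hm i hi => ?_
    · by_cases hij : i = j
      · subst hij; omega
      · rcases hcases i hij with h | h | h
        · omega
        · have := hc i (h.1 ▸ hp0); omega
        · omega
    · by_cases hij : i = j
      · subst hij; omega
      · rcases hcases i hij with h | h | h
        · omega
        · omega
        · have := hc i (h.1 ▸ hn0); omega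
    · by_cases hij : i = j
      · subst hij; omega
      · rcases hcases i hij with h | h | h
        · have := hab i; omega
        · have := hc i (h.1 ▸ hp0); omega
        · have := hc i (h.1 ▸ hn0); omega
    · have := hnb i
      by_cases hij : i = j
      · subst hij; omega
      · rcases hcases i hij with h | h | h <;> omega
    · have h1 := hm j
      have h2 := hcut.2 j
      rcases hjj with h | h
      · have := h2.2 h.1; omega
      · have := h2.1 h.1; omega
    · obtain ⟨hm3, hm4⟩ := mem_cutBox.1 hm
      by_contra! hcon
      have hother : ∀ i, i ≠ j → (ς i = SignType.neg → m i < c i) ∧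
          (ς i = SignType.pos → c i < m i) := by
        intro i hij
        have h5 := hcon i
        rcases hcases i hij with h | h | h
        · rw [h.1]; exact ⟨fun h => absurd h.symm hn0, fun h => absurd h.symm hp0⟩
        · rw [h.1]; exact ⟨fun h => absurd h hpn, fun _ => by omega⟩
        · rw [h.1]; exact ⟨fun _ => by omega, fun h => absurd h.symm hpn⟩
      have h6 := hm3 i
      by_cases hij : i = j
      · subst hij
        refine hm4 ⟨hς, fun k => ?_⟩
        by_cases hki : k = i
        · subst hki
          rcases hjj with h | h
          · rw [h.1]; exact ⟨fun h => absurd h hpn, fun _ => by omega⟩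
          · rw [h.1]; exact ⟨fun _ => by omega, fun h => absurd h.symm hpn⟩
        · exact hother k hki
      · have h7 := hother i hij
        rcases hcases i hij with h | h | h
        · omega
        · have := h7.2 h.1; omega
        · have := h7.1 h.1; omega

end MSA

/-! ### Slabs and half-spaces of elementary regions as wide generalized regions -/

namespace MSA

variable {d : ℕ}

/-- Boxes with even side lengths and cut-out corners are generalized elementary regions. -/
theorem cutBox_mem_generalizedElementaryRegions (hd : 1 ≤ d) {a b c : Fin d → ℤ}
    {ς : Fin d → SignType} (hab : ∀ i, ∃ k : ℕ, b i = a i + 2 * k) :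
    cutBox a b ς c ∈ generalizedElementaryRegions d := by
  choose m hm using hab
  have hp0 : (SignType.pos : SignType) ≠ 0 := by decide
  have hn0 : (SignType.neg : SignType) ≠ 0 := by decide
  have hpn : (SignType.pos : SignType) ≠ SignType.neg := by decide
  have hrect : ∀ n, n ∈ rectangle (fun i => a i + m i) m ↔ ∀ i, a i ≤ n i ∧ n i ≤ b i := by
    intro n
    simp only [rectangle, Fintype.mem_piFinset, Finset.mem_Icc]
    exact forall_congr' fun i => ⟨fun h => by have := hm i; omega, fun h => by have := hm i; omega⟩
  have hshift : ∀ (z n : Fin d → ℤ), n ∈ (rectangle (fun i => a i + m i) m).image (fun n => n + z)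
      ↔ ∀ i, a i ≤ n i - z i ∧ n i - z i ≤ b i := by
    intro z n
    rw [Finset.mem_image]
    constructor
    · rintro ⟨k, hk, rfl⟩ i
      have := (hrect k).1 hk i
      simp only [Pi.add_apply]; omega
    · intro h
      exact ⟨n - z, (hrect _).2 fun i => h i, by simp⟩
  by_cases hς : ς = 0
  · subst hς
    refine ⟨fun i => a i + m i, m, fun i => b i - a i + 1, ?_⟩
    ext n
    rw [Finset.mem_sdiff, hrect, hshift, mem_cutBox]
    refine and_congr_right fun h => iff_of_true (not_isCut_zero _ _) fun h2 => ?_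
    have h3 := h ⟨0, hd⟩
    have h4 := h2 ⟨0, hd⟩
    omega
  -- The translate must meet the box exactly in the removed corner: its lower face is moved to `c i
  -- + 1` for a positive sign, its upper face to `c i - 1` for a negative one. The truncation at `0`
  -- handles a corner outside the box.
  · refine ⟨fun i => a i + m i, m, fun i => if ς i = SignType.pos then max 0 (c i + 1 - a i)
      else if ς i = SignType.neg then min 0 (c i - 1 - b i) else 0, ?_⟩
    ext n
    rw [Finset.mem_sdiff, hrect, hshift, mem_cutBox]
    refine and_congr_right fun h => not_congr ?_
    simp only [IsCut, ne_eq, hς, not_false_eq_true, true_and]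
    refine forall_congr' fun i => ?_
    have hi := h i
    rcases signType_cases (ς i) with h2 | h2 | h2
    · simp only [h2, hp0.symm, hn0.symm, if_false, false_imp_iff, and_self, true_iff]
      omega
    · simp only [h2, hpn.symm, if_false, if_true, forall_const, false_imp_iff, and_true]
      omega
    · simp only [h2, hpn, if_true, forall_const, false_imp_iff, true_and]
      omega

lemma center_mem_cutBox {c : Fin d → ℤ} {ς : Fin d → SignType} (N : ℕ) :
    c ∈ cutBox (fun i => c i - N) (fun i => c i + N) ς c := by
  refine mem_cutBox.2 ⟨fun i => by omega, fun h => h.1 ?_⟩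
  ext1 i
  have := h.2 i
  simp only [lt_self_iff_false, imp_false] at this
  rcases signType_cases (ς i) with h2 | h2 | h2
  · exact h2
  · exact absurd h2 this.1
  · exact absurd h2 this.2

lemma elementaryRegions_nonempty {Λ : Finset (Fin d → ℤ)} {N : ℕ}
    (h : Λ ∈ elementaryRegions d N) : Λ.Nonempty := by
  obtain ⟨c, ς, -, rfl⟩ := mem_elementaryRegions_iff.1 h
  exact ⟨c, center_mem_cutBox N⟩

lemma abs_sub_le_of_mem_elementaryRegions {Λ : Finset (Fin d → ℤ)} {N : ℕ}
    (h : Λ ∈ elementaryRegions d N) {x y : Fin d → ℤ} (hx : x ∈ Λ) (hy : y ∈ Λ) (i : Fin d) :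
    |x i - y i| ≤ 2 * N := by
  obtain ⟨c, ς, -, rfl⟩ := mem_elementaryRegions_iff.1 h
  have h1 : c i - N ≤ x i ∧ x i ≤ c i + N := (mem_cutBox.1 hx).1 i
  have h2 : c i - N ≤ y i ∧ y i ≤ c i + N := (mem_cutBox.1 hy).1 i
  rw [abs_le]
  omega

lemma card_le_of_mem_elementaryRegions {Λ : Finset (Fin d → ℤ)} {N : ℕ}
    (h : Λ ∈ elementaryRegions d N) : Λ.card ≤ (2 * N + 1) ^ d := by
  classical
  obtain ⟨c, ς, -, rfl⟩ := mem_elementaryRegions_iff.1 h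
  refine (Finset.card_filter_le _ _).trans ?_
  rw [Fintype.card_piFinset]
  refine (Finset.prod_le_pow_card _ _ (2 * N + 1) fun i _ => ?_).trans (by simp)
  rw [Int.card_Icc]
  beta_reduce
  omega

lemma diam_le_of_subset_elementaryRegions {Λ S : Finset (Fin d → ℤ)} {N : ℕ}
    (h : Λ ∈ elementaryRegions d N) (hS : S ⊆ Λ) :
    Metric.diam (S : Set (Fin d → ℤ)) ≤ 2 * N := by
  refine Metric.diam_le_of_forall_dist_le (by positivity) fun x hx y hy => ?_
  rw [dist_pi_le_iff (by positivity)]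
  intro i
  rw [Int.dist_eq]
  exact_mod_cast abs_sub_le_of_mem_elementaryRegions h (hS hx) (hS hy) i

/-- A segment of `N + 1` sites from the center in direction `j` survives the cut, since a second
signed coordinate still equals that of the center. This bounds the sizes that compete in `width`. -/
lemma lt_card_of_mem_elementaryRegions (hd : 1 ≤ d) {Λ : Finset (Fin d → ℤ)} {N : ℕ}
    (h : Λ ∈ elementaryRegions d N) : N < Λ.card := by
  obtain ⟨c, ς, hς, rfl⟩ := mem_elementaryRegions_iff.1 h
  obtain ⟨j, hj⟩ : ∃ j : Fin d, ς = 0 ∨ ∃ i, i ≠ j ∧ ς i ≠ 0 := by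
    rcases hς with h0 | ⟨i, j, hij, hi, -⟩
    · exact ⟨⟨0, hd⟩, Or.inl h0⟩
    · exact ⟨j, Or.inr ⟨i, hij, hi⟩⟩
  have hle := Finset.card_le_card_of_injOn (s := Finset.range (N + 1))
    (t := cutBox (fun i => c i - N) (fun i => c i + N) ς c)
    (fun t => Function.update c j (c j + t)) (fun t ht => ?_) (fun t _ t' _ htt => ?_)
  · rw [Finset.card_range] at hle
    omega
  · have ht' : t < N + 1 := by simpa using ht
    refine mem_cutBox.2 ⟨fun i => ?_, fun hcut => ?_⟩
    · by_cases hij : i = j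
      · subst hij; simp only [Function.update_self]; omega
      · simp only [Function.update_of_ne hij]; omega
    · rcases hj with h0 | ⟨i, hij, hi⟩
      · exact hcut.1 h0
      · have := hcut.2 i
        simp only [Function.update_of_ne hij, lt_self_iff_false, imp_false] at this
        rcases signType_cases (ς i) with h2 | h2 | h2
        · exact hi h2
        · exact this.1 h2
        · exact this.2 h2
  · have := congrFun htt j
    simp only [Function.update_self] at this
    omega

/-- The supremum in `ℕ` is meaningful only for a bounded set of sizes, which is why `Λ` must be
nonempty and `d` positive. -/
lemma WidthCondition.le_width (hd : 1 ≤ d) {Λ : Finset (Fin d → ℤ)} {M : ℕ}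
    (h : WidthCondition Λ M) (hne : Λ.Nonempty) : M ≤ width Λ := by
  refine le_csSup ⟨Λ.card, fun k hk => ?_⟩ h
  obtain ⟨n, hn⟩ := hne
  obtain ⟨W, hW, -, hWΛ, -⟩ := hk n hn
  exact (lt_card_of_mem_elementaryRegions hd hW).le.trans (Finset.card_le_card hWΛ)

lemma widthCondition_self {Λ : Finset (Fin d → ℤ)} {N : ℕ} (h : Λ ∈ elementaryRegions d N) :
    WidthCondition Λ N := fun n hn => ⟨Λ, h, hn, subset_rfl, fun m hm => by simp at hm⟩

/-- Elementary regions are wide relative to smaller sizes. -/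
lemma widthCondition_of_mem_elementaryRegions {Λ : Finset (Fin d → ℤ)} {N M : ℕ}
    (h : Λ ∈ elementaryRegions d N) (hM : 2 * M + 1 ≤ N) : WidthCondition Λ M := by
  obtain ⟨c, ς, -, rfl⟩ := mem_elementaryRegions_iff.1 h
  exact widthCondition_cutBox (fun i => by omega) fun i _ => by omega

lemma elementaryRegions_subset_generalized (hd : 1 ≤ d) {Λ : Finset (Fin d → ℤ)} {N : ℕ}
    (h : Λ ∈ elementaryRegions d N) : Λ ∈ generalizedElementaryRegions d := by
  obtain ⟨c, ς, -, rfl⟩ := mem_elementaryRegions_iff.1 h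
  exact cutBox_mem_generalizedElementaryRegions hd fun i => ⟨N, by ring⟩

/-- Elementary regions are regions of the norm bound. -/
lemma mem_wideRegions_of_mem_elementaryRegions (hd : 1 ≤ d) {Λ : Finset (Fin d → ℤ)} {N : ℕ}
    {w : ℝ} (h : Λ ∈ elementaryRegions d N) (hw : w ≤ N) : Λ ∈ wideRegions d (2 * N) w :=
  ⟨elementaryRegions_subset_generalized hd h, diam_le_of_subset_elementaryRegions h subset_rfl,
    hw.trans (by exact_mod_cast
      (widthCondition_self h).le_width hd (elementaryRegions_nonempty h))⟩

/-- The part of a cut box in a slab is a cut box. -/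
lemma filter_cutBox_eq {a b c : Fin d → ℤ} {ς : Fin d → SignType} (hς : AdmissibleSigns ς)
    {i : Fin d} {p q : ℤ} (hp : a i ≤ p) (hq : q ≤ b i) :
    ∃ ς' : Fin d → SignType, (∀ k, ς' k ≠ 0 → ς k ≠ 0) ∧ (c i < p ∨ q < c i → ς' i = 0) ∧
      (cutBox a b ς c).filter (fun n => p ≤ n i ∧ n i ≤ q)
        = cutBox (Function.update a i p) (Function.update b i q) ς' c := by
  have hp0 : (SignType.pos : SignType) ≠ 0 := by decide
  have hn0 : (SignType.neg : SignType) ≠ 0 := by decide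
  have hpn : (SignType.pos : SignType) ≠ SignType.neg := by decide
  have hbox : ∀ n : Fin d → ℤ, ((∀ k, a k ≤ n k ∧ n k ≤ b k) ∧ (p ≤ n i ∧ n i ≤ q)) ↔
      ∀ k, Function.update a i p k ≤ n k ∧ n k ≤ Function.update b i q k := by
    intro n
    constructor
    · rintro ⟨h1, h2⟩ k
      by_cases hk : k = i
      · subst hk; simpa using h2
      · simpa [Function.update_of_ne hk] using h1 k
    · intro h
      have hi := h i
      simp only [Function.update_self] at hi
      refine ⟨fun k => ?_, hi⟩
      by_cases hk : k = i
      · subst hk; omega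
      · simpa [Function.update_of_ne hk] using h k
  have key : ∀ ς' : Fin d → SignType,
      (∀ n : Fin d → ℤ, p ≤ n i → n i ≤ q → (IsCut ς c n ↔ IsCut ς' c n)) →
      (cutBox a b ς c).filter (fun n => p ≤ n i ∧ n i ≤ q)
        = cutBox (Function.update a i p) (Function.update b i q) ς' c := by
    intro ς' h
    ext n
    rw [Finset.mem_filter, mem_cutBox, mem_cutBox, ← hbox, and_right_comm]
    exact and_congr_right fun hn => not_congr (h n hn.2.1 hn.2.2)
  by_cases hc : c i < p ∨ q < c i
  swap
  · exact ⟨ς, fun _ h => h, fun h => absurd h hc, key ς fun _ _ _ => Iff.rfl⟩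
  by_cases hi : ς i = 0
  · exact ⟨ς, fun _ h => h, fun _ => hi, key ς fun _ _ _ => Iff.rfl⟩
  -- If the slab lies on the removed side of the corner in direction `i`, the condition at `i` is
  -- automatic and its sign is dropped; a second nonzero sign keeps the cut nontrivial. On the
  -- allowed side nothing is cut at all.
  by_cases hside : (ς i = SignType.pos ∧ c i < p) ∨ (ς i = SignType.neg ∧ q < c i)
  · refine ⟨Function.update ς i 0, fun k hk => ?_, fun _ => by simp, key _ fun n h1 h2 => ?_⟩
    · by_cases hki : k = i
      · subst hki; simp at hk
      · rwa [Function.update_of_ne hki] at hk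
    · have hς0 : ς ≠ 0 := fun h => hi (by rw [h]; rfl)
      have hς'0 : Function.update ς i 0 ≠ 0 := by
        obtain ⟨k, l, hkl, hk, hl⟩ := hς.resolve_left hς0
        intro h
        by_cases hki : k = i
        · subst hki
          have := congrFun h l
          rw [Function.update_of_ne hkl.symm] at this
          exact hl this
        · have := congrFun h k
          rw [Function.update_of_ne hki] at this
          exact hk this
      refine ⟨fun h => ⟨hς'0, fun k => ?_⟩, fun h => ⟨hς0, fun k => ?_⟩⟩
      · by_cases hki : k = i
        · subst hki; simp
        · rw [Function.update_of_ne hki]; exact h.2 k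
      · by_cases hki : k = i
        · subst hki
          rcases hside with ⟨h3, h4⟩ | ⟨h3, h4⟩
          · rw [h3]; exact ⟨fun h => absurd h hpn, fun _ => by omega⟩
          · rw [h3]; exact ⟨fun _ => by omega, fun h => absurd h.symm hpn⟩
        · have := h.2 k
          rwa [Function.update_of_ne hki] at this
  · refine ⟨0, fun k hk => absurd rfl hk, fun _ => rfl, key _ fun n h1 h2 =>
      iff_of_false (fun h => ?_) (not_isCut_zero _ _)⟩
    have h3 := h.2 i
    rcases signType_cases (ς i) with h4 | h4 | h4
    · exact hi h4
    · have := h3.1 h4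
      exact hside (Or.inr ⟨h4, by omega⟩)
    · have := h3.2 h4
      exact hside (Or.inl ⟨h4, by omega⟩)

/-- Slabs of elementary regions are generalized elementary and wide, if they have even length
and their faces are far from the center. -/
lemma slab_generalized_and_wide (hd : 1 ≤ d) {c : Fin d → ℤ} {ς : Fin d → SignType}
    (hς : AdmissibleSigns ς) {L M : ℕ} (hL : 2 * M + 1 ≤ L) {i : Fin d} {p q : ℤ}
    (hp : c i - L ≤ p) (hq : q ≤ c i + L) (hpq : p + 2 * M ≤ q) (heven : ∃ k : ℕ, q = p + 2 * k)
    (hc : c i < p ∨ q < c i ∨ (p + 2 * M + 1 ≤ c i ∧ c i + 2 * M + 1 ≤ q)) :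
    (cutBox (fun i => c i - L) (fun i => c i + L) ς c).filter (fun n => p ≤ n i ∧ n i ≤ q)
        ∈ generalizedElementaryRegions d ∧
    WidthCondition
      ((cutBox (fun i => c i - L) (fun i => c i + L) ς c).filter
        (fun n => p ≤ n i ∧ n i ≤ q)) M := by
  obtain ⟨ς', h1, h2, h3⟩ := filter_cutBox_eq (a := fun i => c i - L) (b := fun i => c i + L)
    (c := c) hς hp hq
  rw [h3]
  refine ⟨cutBox_mem_generalizedElementaryRegions hd fun k => ?_,
    widthCondition_cutBox (fun k => ?_) fun k hk => ?_⟩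
  · by_cases hki : k = i
    · subst hki; simpa using heven
    · simp only [Function.update_of_ne hki]; exact ⟨L, by ring⟩
  · by_cases hki : k = i
    · subst hki; simpa using hpq
    · simp only [Function.update_of_ne hki]; omega
  · by_cases hki : k = i
    · subst hki
      simp only [Function.update_self]
      rcases hc with h | h | h
      · exact absurd (h2 (Or.inl h)) hk
      · exact absurd (h2 (Or.inr h)) hk
      · exact h
    · simp only [Function.update_of_ne hki]; omega

end MSA

namespace MSA

variable {d : ℕ}

lemma slab_mem_wideRegions (hd : 1 ≤ d) {c : Fin d → ℤ} {ς : Fin d → SignType}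
    (hς : AdmissibleSigns ς) {L M : ℕ} (hL : 2 * M + 1 ≤ L) {i : Fin d} {p q : ℤ}
    (hp : c i - L ≤ p) (hq : q ≤ c i + L) (hpq : p + 2 * M ≤ q) (heven : ∃ k : ℕ, q = p + 2 * k)
    (hc : c i < p ∨ q < c i ∨ (p + 2 * M + 1 ≤ c i ∧ c i + 2 * M + 1 ≤ q))
    (hne : ((cutBox (fun i => c i - L) (fun i => c i + L) ς c).filter
      (fun n => p ≤ n i ∧ n i ≤ q)).Nonempty) :
    (cutBox (fun i => c i - L) (fun i => c i + L) ς c).filter (fun n => p ≤ n i ∧ n i ≤ q)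
      ∈ wideRegions d (2 * L) M := by
  obtain ⟨h1, h2⟩ := slab_generalized_and_wide hd hς hL hp hq hpq heven hc
  exact ⟨h1, diam_le_of_subset_elementaryRegions (mem_elementaryRegions_iff.2 ⟨c, ς, hς, rfl⟩)
    (Finset.filter_subset _ _), by exact_mod_cast h2.le_width hd hne⟩

/-- Half of an elementary region `Λ` in a direction `± e_i`, if its face is not close to the center
or to the opposite face, and lies at an even distance from the latter. -/
lemma halfspace_mem_wideRegions (hd : 1 ≤ d) {c : Fin d → ℤ} {ς : Fin d → SignType}
    (hς : AdmissibleSigns ς) {L M : ℕ} (hL : 2 * M + 1 ≤ L) {i : Fin d} {ε t : ℤ}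
    (hε : ε = 1 ∨ ε = -1) (ht : ε * c i - L + 2 * M ≤ t)
    (htc : t + 2 * M + 1 ≤ ε * c i ∨ ε * c i + 2 * M + 1 ≤ t)
    (heven : Even (t - (ε * c i - L)) ∨ ε * c i + L ≤ t)
    (hne : ((cutBox (fun i => c i - L) (fun i => c i + L) ς c).filter
      (fun n => ε * n i ≤ t)).Nonempty) :
    (cutBox (fun i => c i - L) (fun i => c i + L) ς c).filter (fun n => ε * n i ≤ t)
      ∈ wideRegions d (2 * L) M := by
  by_cases htop : ε * c i + L ≤ t
  · rw [Finset.filter_true_of_mem]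
    · exact mem_wideRegions_of_mem_elementaryRegions hd
        (mem_elementaryRegions_iff.2 ⟨c, ς, hς, rfl⟩) (by exact_mod_cast (by omega : M ≤ L))
    · intro n hn
      have := (mem_cutBox.1 hn).1 i
      beta_reduce at this
      rcases hε with rfl | rfl <;> omega
  obtain ⟨k, hk⟩ := heven.resolve_right htop
  rcases hε with rfl | rfl
  · have hS : (cutBox (fun i => c i - L) (fun i => c i + L) ς c).filter (fun n => 1 * n i ≤ t)
        = (cutBox (fun i => c i - L) (fun i => c i + L) ς c).filter
          (fun n => c i - L ≤ n i ∧ n i ≤ t) := by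
      refine Finset.filter_congr fun n hn => ?_
      have := (mem_cutBox.1 hn).1 i
      beta_reduce at this
      omega
    rw [hS] at hne ⊢
    exact slab_mem_wideRegions hd hς hL (by omega) (by omega) (by omega)
      ⟨k.toNat, by omega⟩ (by omega) hne
  · have hS : (cutBox (fun i => c i - L) (fun i => c i + L) ς c).filter (fun n => -1 * n i ≤ t)
        = (cutBox (fun i => c i - L) (fun i => c i + L) ς c).filter
          (fun n => -t ≤ n i ∧ n i ≤ c i + L) := by
      refine Finset.filter_congr fun n hn => ?_
      have := (mem_cutBox.1 hn).1 i
      beta_reduce at this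
      omega
    rw [hS] at hne ⊢
    exact slab_mem_wideRegions hd hς hL (by omega) (by omega) (by omega)
      ⟨k.toNat, by omega⟩ (by omega) hne

/-! ### One step of the multi-scale analysis -/

/-- A maximal disjoint subfamily of a finite family of nonempty sets meets every member. -/
lemma exists_maximal_disjoint {α : Type*} [DecidableEq α] (𝓑 : Finset (Finset α))
    (h𝓑 : ∀ W ∈ 𝓑, W.Nonempty) :
    ∃ F ⊆ 𝓑, (∀ W ∈ F, ∀ W' ∈ F, W ≠ W' → Disjoint W W') ∧
      ∀ W ∈ 𝓑, ∃ G ∈ F, ∃ y, y ∈ W ∧ y ∈ G := by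
  classical
  obtain ⟨F, hF, hmax⟩ := Finset.exists_max_image
    (𝓑.powerset.filter fun F => ∀ W ∈ F, ∀ W' ∈ F, W ≠ W' → Disjoint W W') Finset.card
    ⟨∅, by simp⟩
  obtain ⟨hF1, hF2⟩ := Finset.mem_filter.1 hF
  rw [Finset.mem_powerset] at hF1
  refine ⟨F, hF1, hF2, fun W hW => ?_⟩
  by_contra! hcon
  have hdisj : ∀ G ∈ F, Disjoint W G := fun G hG =>
    Finset.disjoint_left.2 fun y hy => hcon G hG y hy
  have hWF : W ∉ F := fun h => by
    obtain ⟨y, hy⟩ := h𝓑 W hW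
    exact hcon W h y hy hy
  have hins := hmax (insert W F) (Finset.mem_filter.2
    ⟨Finset.mem_powerset.2 (Finset.insert_subset hW hF1), fun G hG G' hG' hne => ?_⟩)
  · rw [Finset.card_insert_of_notMem hWF] at hins
    omega
  · rcases Finset.mem_insert.1 hG with h1 | h1 <;> rcases Finset.mem_insert.1 hG' with h2 | h2
    · exact absurd (h1.trans h2.symm) hne
    · exact h1 ▸ hdisj G' h2
    · exact h2 ▸ (hdisj G h1).symm
    · exact hF2 G h1 G' h2 hne

lemma exists_first_notMem (Z : Finset ℤ) (t : ℤ) :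
    ∃ t₁, t ≤ t₁ ∧ t₁ ∉ Z ∧ ∀ s, t ≤ s → s < t₁ → s ∈ Z := by
  classical
  have hex : ∃ k : ℕ, t + k ∉ Z := by
    by_contra! hcon
    exact Set.infinite_of_injective_forall_mem (f := fun k : ℕ => t + k)
      (fun a b h => by simpa using h) hcon Z.finite_toSet
  refine ⟨t + Nat.find hex, by omega, Nat.find_spec hex, fun s h1 h2 => ?_⟩
  have := Nat.find_min hex (m := (s - t).toNat) (by omega)
  rw [not_not] at this
  rwa [Int.toNat_of_nonneg (by omega), add_sub_cancel] at this

/-- The sup norm is attained in one coordinate, so a barrier depending on this coordinate alone sees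
the full distance. -/
lemma exists_coordinate (hd : 1 ≤ d) (x y : Fin d → ℤ) :
    ∃ (i : Fin d) (ε : ℤ), (ε = 1 ∨ ε = -1) ∧ ‖x - y‖ = ((ε * y i : ℤ) : ℝ) - (ε * x i : ℤ) := by
  have : Nonempty (Fin d) := ⟨⟨0, hd⟩⟩
  obtain ⟨i, hi⟩ := Finite.exists_max fun i => ‖(x - y) i‖
  have h1 : ‖x - y‖ = ‖(x - y) i‖ :=
    le_antisymm ((pi_norm_le_iff_of_nonneg (norm_nonneg _)).2 hi) (norm_le_pi_norm _ i)
  rw [Pi.sub_apply, Int.norm_eq_abs] at h1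
  push_cast at h1
  rcases le_total 0 ((x i : ℝ) - y i) with h | h
  · refine ⟨i, -1, Or.inr rfl, ?_⟩
    rw [h1, abs_of_nonneg h]; push_cast; ring
  · refine ⟨i, 1, Or.inl rfl, ?_⟩
    rw [h1, abs_of_nonpos h]; push_cast; ring

lemma abs_coordinate_sub_le {ε : ℤ} (hε : ε = 1 ∨ ε = -1) (i : Fin d) (x y : Fin d → ℤ) :
    |((ε * x i : ℤ) : ℝ) - (ε * y i : ℤ)| ≤ ‖x - y‖ := by
  have h := norm_le_pi_norm (x - y) i
  rw [Pi.sub_apply, Int.norm_eq_abs] at h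
  push_cast at h ⊢
  rcases hε with rfl | rfl
  · simpa using h
  · rw [← abs_neg]
    refine le_trans (le_of_eq ?_) h
    congr 1
    push_cast; ring

/-- The skipped length only changes the rate of decay. -/
lemma le_exp_of_effLength {σ' c η D e z C Q L : ℝ} (hσ0 : 0 < σ') (hσ1 : σ' ≤ 1) (hη : 0 ≤ η)
    (hηc : η ≤ c) (he : 0 ≤ e) (hz : 0 ≤ z) (hL : 0 ≤ L) (hD : L / 10 ≤ D) (hDe : D ≤ e + z)
    (hQ : 0 ≤ Q) (hfin : Q * Real.exp (c * z ^ σ') ≤ Real.exp (η * (L / 10) ^ σ'))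
    (hC : C ≤ Q * Real.exp (-(c - η) * e ^ σ')) :
    C ≤ Real.exp (-(c - 2 * η) * D ^ σ') := by
  have hD0 : 0 ≤ D := le_trans (by positivity) hD
  have h1 : D ^ σ' ≤ e ^ σ' + z ^ σ' :=
    rpow_le_rpow_add_of_le_add hD0 he hz hσ0.le hσ1 hDe
  have h2 : (L / 10) ^ σ' ≤ D ^ σ' := Real.rpow_le_rpow (by positivity) hD hσ0.le
  have h3 : 0 ≤ z ^ σ' := by positivity
  calc C ≤ Q * Real.exp (-(c - η) * e ^ σ') := hC
    _ ≤ Q * Real.exp (c * z ^ σ' + -(c - η) * D ^ σ') := by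
      gcongr
      have h4 : (c - η) * D ^ σ' ≤ (c - η) * (e ^ σ' + z ^ σ') :=
        mul_le_mul_of_nonneg_left h1 (by linarith)
      have h5 : 0 ≤ η * z ^ σ' := by positivity
      linarith
    _ = Q * Real.exp (c * z ^ σ') * Real.exp (-(c - η) * D ^ σ') := by
      rw [Real.exp_add]; ring
    _ ≤ Real.exp (η * (L / 10) ^ σ') * Real.exp (-(c - η) * D ^ σ') := by gcongr
    _ ≤ Real.exp (η * D ^ σ') * Real.exp (-(c - η) * D ^ σ') := by gcongr
    _ = _ := by rw [← Real.exp_add]; ring_nf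

section step

variable {A : Matrix (Fin d → ℤ) (Fin d → ℤ) ℂ} {K c₁ c η σ' : ℝ} {M L : ℕ} {E E₁ V : ℝ}
  {Λ : Finset (Fin d → ℤ)}

/-- One step of the multi-scale analysis: an elementary region with few bad disjoint subregions
of size `M` and with bounded inverses on wide subregions has a decaying Green's function. -/
theorem greenDecay_of_few_bad (hd : 1 ≤ d) (hA : SubexpDecay A K c₁ σ') (hK : 0 ≤ K)
    (hσ0 : 0 < σ') (hσ1 : σ' ≤ 1) (hη : 0 ≤ η) (hηc : η ≤ c) (hc₁ : 0 ≤ c₁)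
    (hc : c ≤ ((5 : ℝ) ^ σ' - 1) / (5 : ℝ) ^ σ' * c₁) (hM : 1 ≤ M) (hML : 2 * M + 3 ≤ L)
    (hΛ : Λ ∈ elementaryRegions d L) (hE : 1 ≤ E)
    (hnorm : ∀ S ∈ wideRegions d (2 * L) (M + 1 : ℕ), S ⊆ Λ →
      IsUnit (restrict A S) ∧ opNorm (green A S) ≤ E)
    {T : ℝ} (hT : ∀ F : Finset (Finset (Fin d → ℤ)),
      (∀ W ∈ F, W ∈ elementaryRegions d M ∧ W ⊆ Λ ∧ ¬ GreenDecay A c σ' M W) →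
      (∀ W ∈ F, ∀ W' ∈ F, W ≠ W' → Disjoint W W') → (F.card : ℝ) ≤ T)
    (hV : (Λ.card : ℝ) ≤ V)
    (hnear : V ^ 2 * K * E * Real.exp (-c * ((M : ℝ) / 2) ^ σ') ≤ 1 / 2)
    (hE₁ : 1 ≤ E₁) (hEE : E ≤ E₁) (hVE : 2 * V ^ 2 * K * E ≤ E₁)
    (hsmall : 2 * V ^ 2 * (2 * E) * K * E₁ ≤ Real.exp (η * ((M : ℝ) / 2) ^ σ'))
    (hexp : E₁ ≤ Real.exp (η * (M : ℝ) ^ σ'))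
    (hfin : 2 * (2 * E) * E₁ * Real.exp (c * (M : ℝ) ^ σ') *
      Real.exp (c * (T * (10 * M + 1) + (6 * M + 12)) ^ σ') ≤
        Real.exp (η * ((L : ℝ) / 10) ^ σ')) :
    GreenDecay A (c - 2 * η) σ' L Λ := by
  classical
  have hc₀ : 0 ≤ c := hη.trans hηc
  have hUΛ := hnorm Λ (mem_wideRegions_of_mem_elementaryRegions hd hΛ
    (by exact_mod_cast (by omega : M + 1 ≤ L))) subset_rfl
  have hwidth := widthCondition_of_mem_elementaryRegions hΛ (M := M) (by omega)
  have hW' : ∀ x : Fin d → ℤ, ∃ W : Finset (Fin d → ℤ), x ∈ Λ → W ∈ elementaryRegions d M ∧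
      x ∈ W ∧ W ⊆ Λ ∧ ∀ m ∈ Λ \ W, (M : ℝ) / 2 ≤ ‖x - m‖ := fun x => by
    by_cases hx : x ∈ Λ
    · obtain ⟨W, hW⟩ := hwidth x hx
      exact ⟨W, fun _ => hW⟩
    · exact ⟨∅, fun h => absurd h hx⟩
  choose W hW using hW'
  set Bad : Set (Fin d → ℤ) := {x | ¬ GreenDecay A c σ' M (W x)} with hBad
  obtain ⟨F, hF, hFd, hFm⟩ := exists_maximal_disjoint ((Λ.filter (· ∈ Bad)).image W)
    (fun U hU => by
      obtain ⟨x, hx, rfl⟩ := Finset.mem_image.1 hU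
      exact ⟨x, (hW x (Finset.mem_filter.1 hx).1).2.1⟩)
  have hFprop : ∀ U ∈ F, U ∈ elementaryRegions d M ∧ U ⊆ Λ ∧ ¬ GreenDecay A c σ' M U := by
    intro U hU
    obtain ⟨x, hx, rfl⟩ := Finset.mem_image.1 (hF hU)
    obtain ⟨hx1, hx2⟩ := Finset.mem_filter.1 hx
    exact ⟨(hW x hx1).1, (hW x hx1).2.2.1, hx2⟩
  have hFcard := hT F hFprop hFd
  have hT0 : 0 ≤ T := le_trans (by positivity) hFcard
  have hr' : ∀ G : Finset (Fin d → ℤ), ∃ r : Fin d → ℤ, G ∈ F → r ∈ G := fun G => by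
    by_cases hG : G ∈ F
    · obtain ⟨r, hr⟩ := elementaryRegions_nonempty (hFprop G hG).1
      exact ⟨r, fun _ => hr⟩
    · exact ⟨0, fun h => absurd h hG⟩
  choose r hr using hr'
  refine greenDecay_iff.2 ⟨hUΛ.1, fun x₀ hx₀ y hy hD => ?_⟩
  obtain ⟨i, ε, hε, hDeq⟩ := exists_coordinate hd x₀ y
  obtain ⟨a, ς, hς, hΛeq⟩ := mem_elementaryRegions_iff.1 hΛ
  set π : (Fin d → ℤ) → ℤ := fun n => ε * n i with hπdef
  set q : ℤ := ε * a i with hq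
  have hπM : ∀ U ∈ elementaryRegions d M, ∀ u ∈ U, ∀ v ∈ U, |π u - π v| ≤ 2 * M := by
    intro U hU u hu v hv
    have h := abs_sub_le_of_mem_elementaryRegions hU hu hv i
    rw [abs_le] at h ⊢
    simp only [hπdef]
    rcases hε with rfl | rfl <;> omega
  have hπΛ : ∀ x ∈ Λ, q - L ≤ π x := by
    intro x hx
    rw [hΛeq] at hx
    have h := (mem_cutBox.1 hx).1 i
    beta_reduce at h
    simp only [hπdef, hq]
    rcases hε with rfl | rfl <;> omega
  -- The radius is `5 * M = 2 * M + 2 * M + M`: from a bad site to a common site of its region and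
  -- `G`, from there to the representative of `G`, and a margin `M` that separates later bad sites
  -- from the chosen face.
  set Z₁ : Finset ℤ := F.biUnion fun G => Finset.Icc (π (r G) - 5 * M) (π (r G) + 5 * M) with hZ₁
  -- Levels near the lower face of `Λ` and near its center are skipped too, since half-spaces ending
  -- there would be thin or would have the corner too close to a face. The extra `2` leaves room for
  -- a parity shift.
  set Z : Finset ℤ := Z₁ ∪ (Finset.Icc (q - L) (q - L + 2 * (M + 1) + 2) ∪
    Finset.Icc (q - 2 * (M + 1)) (q + 2 * (M + 1) + 2)) with hZ
  have hZcard : (Z.card : ℝ) ≤ T * (10 * M + 1) + (6 * M + 12) := by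
    have h1 : Z₁.card ≤ F.card * (10 * M + 1) := by
      refine Finset.card_biUnion_le_card_mul _ _ _ fun G _ => ?_
      rw [Int.card_Icc]; omega
    have h2 : Z.card ≤ F.card * (10 * M + 1) + (6 * M + 12) := by
      refine (Finset.card_union_le _ _).trans (add_le_add h1
        ((Finset.card_union_le _ _).trans ?_))
      rw [Int.card_Icc, Int.card_Icc]; omega
    calc (Z.card : ℝ) ≤ F.card * (10 * M + 1) + (6 * M + 12) := by exact_mod_cast h2
      _ ≤ _ := by gcongr
  have hZ₁mem : ∀ x ∈ Λ, x ∈ Bad → ∀ s, |s - π x| ≤ M → s ∈ Z := by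
    intro x hx hxB s hs
    obtain ⟨G, hG, u, hu1, hu2⟩ := hFm (W x)
      (Finset.mem_image_of_mem W (Finset.mem_filter.2 ⟨hx, hxB⟩))
    have h1 := hπM (W x) (hW x hx).1 x (hW x hx).2.1 u hu1
    have h2 := hπM G (hFprop G hG).1 u hu2 (r G) (hr G hG)
    refine Finset.mem_union_left _ (Finset.mem_biUnion.2 ⟨G, hG, Finset.mem_Icc.2 ?_⟩)
    rw [abs_le] at h1 h2 hs
    omega
  have hgood : ∀ x ∈ Λ, x ∉ Bad → GoodSite A c σ' M (2 * E) Λ x := by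
    intro x hx hxB
    have hG : GreenDecay A c σ' M (W x) := by
      simpa [hBad] using hxB
    obtain ⟨-, h2, h3, h4⟩ := hW x hx
    -- The norm bound is assumed from width `M + 1` on and need not cover `W x` itself, so the row
    -- bound is transferred from `Λ`.
    exact ⟨W x, h3, h2, hG, h4, norm_greenFn_le_of_subset hA hK hσ0 hσ1 hc₀ hc₁ hc hG h3 hUΛ.1
      hE hUΛ.2 hV hnear h2 h4⟩
  have hbad : ∀ x ∈ Λ, x ∈ Bad → ∃ t : ℤ, π x ≤ t ∧ Finset.Icc (π x) t ⊆ Z ∧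
      IsUnit (restrict A (Λ.filter fun z => π z ≤ t)) ∧
      opNorm (green A (Λ.filter fun z => π z ≤ t)) ≤ E ∧
      ∀ z ∈ Λ, z ∈ Bad → π z ≤ t ∨ t + M ≤ π z := by
    intro x hx hxB
    obtain ⟨t₁, ht1, ht2, ht3⟩ := exists_first_notMem Z (π x)
    have hxt : π x + 1 < t₁ := by
      by_contra hcon
      exact ht2 (hZ₁mem x hx hxB t₁ (by rw [abs_le]; omega))
    have hgap : ¬ (q - L ≤ t₁ ∧ t₁ ≤ q - L + 2 * (M + 1) + 2) ∧
        ¬ (q - 2 * (M + 1) ≤ t₁ ∧ t₁ ≤ q + 2 * (M + 1) + 2) := by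
      constructor <;> intro h <;> refine ht2 (Finset.mem_union_right _ ?_)
      · exact Finset.mem_union_left _ (Finset.mem_Icc.2 h)
      · exact Finset.mem_union_right _ (Finset.mem_Icc.2 h)
    -- Rectangles have even side lengths, so the face is placed one or two levels below `t₁`,
    -- whichever has the right parity.
    have hxq := hπΛ x hx
    obtain ⟨t, ht, hteven⟩ : ∃ t : ℤ, (t = t₁ - 1 ∨ t = t₁ - 2) ∧ Even (t - (q - L)) := by
      rcases Int.even_or_odd (t₁ - 1 - (q - L)) with h | h
      · exact ⟨t₁ - 1, Or.inl rfl, h⟩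
      · refine ⟨t₁ - 2, Or.inr rfl, ?_⟩
        have := h.sub_odd odd_one
        rwa [show t₁ - 1 - (q - L) - 1 = t₁ - 2 - (q - L) by ring] at this
    have hsep : ∀ z ∈ Λ, z ∈ Bad → π z ≤ t ∨ t + M ≤ π z := by
      intro z hz hzB
      by_contra! hcon
      exact ht2 (hZ₁mem z hz hzB t₁ (by rw [abs_le]; omega))
    have hmem : (Λ.filter fun z => π z ≤ t) ∈ wideRegions d (2 * L) (M + 1 : ℕ) := by
      have hxS : x ∈ Λ.filter fun z => π z ≤ t := Finset.mem_filter.2 ⟨hx, by omega⟩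
      rw [hΛeq] at hxS ⊢
      exact halfspace_mem_wideRegions hd hς (by omega) hε (by push_cast; omega)
        (by push_cast; omega) (Or.inl hteven) ⟨x, hxS⟩
    obtain ⟨h1, h2⟩ := hnorm _ hmem (Finset.filter_subset _ _)
    refine ⟨t, by omega, fun s hs => ?_, h1, h2, hsep⟩
    rw [Finset.mem_Icc] at hs
    exact ht3 s hs.1 (by omega)
  have hbound := norm_greenFn_le_of_expansions hA hK hσ0 hσ1 hη hηc hc₁ hc (B := 2 * E)
    (by linarith) hV hUΛ.1 (abs_coordinate_sub_le hε i) hE₁ hEE hVE hsmall hexp hgood hbad hx₀ hy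
  refine le_exp_of_effLength (L := L) hσ0 hσ1 hη hηc (Nat.cast_nonneg _)
    (by positivity) (Nat.cast_nonneg _) hD ?_ (by positivity) hfin hbound
  have h1 : π x₀ ≤ π y := by
    have h2 : (0 : ℝ) ≤ (π y : ℝ) - π x₀ := by
      rw [← hDeq]; exact norm_nonneg _
    exact_mod_cast sub_nonneg.1 h2
  have h3 := le_effLength_add Z h1
  rw [← hDeq] at h3
  linarith

/-- An elementary region has a decaying Green's function if all its subregions of size `M`
have one, and have bounded inverses. -/
theorem greenDecay_of_no_bad (hd : 1 ≤ d) (hA : SubexpDecay A K c₁ σ') (hK : 0 ≤ K)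
    (hσ0 : 0 < σ') (hσ1 : σ' ≤ 1) (hη : 0 ≤ η) (hηc : η ≤ c) (hc₁ : 0 ≤ c₁)
    (hc : c ≤ ((5 : ℝ) ^ σ' - 1) / (5 : ℝ) ^ σ' * c₁) (hML : 2 * M + 1 ≤ L)
    (hΛ : Λ ∈ elementaryRegions d L) (hE : 1 ≤ E)
    (hgood : ∀ W ∈ elementaryRegions d M, W ⊆ Λ → GreenDecay A c σ' M W ∧
      opNorm (green A W) ≤ E)
    (hV : (Λ.card : ℝ) ≤ V)
    (hnear : V ^ 2 * (2 * E) * K * Real.exp (-c * ((M : ℝ) / 2) ^ σ') ≤ 1 / 2)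
    (hsmall : 2 * V ^ 2 * (2 * E) * K ≤ Real.exp (η * ((M : ℝ) / 2) ^ σ'))
    (hfin : 2 * (2 * E) * Real.exp (c * (M : ℝ) ^ σ') ≤ Real.exp (η * ((L : ℝ) / 10) ^ σ')) :
    GreenDecay A (c - 2 * η) σ' L Λ := by
  have hc₀ : 0 ≤ c := hη.trans hηc
  have hV0 : 0 ≤ V := le_trans (by positivity) hV
  have hwidth := widthCondition_of_mem_elementaryRegions hΛ (M := M) (by omega)
  have hgood' : ∀ x ∈ Λ, GoodSite A c σ' M (2 * E) Λ x := by
    intro x hx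
    obtain ⟨W, hW1, hW2, hW3, hW4⟩ := hwidth x hx
    obtain ⟨h1, h2⟩ := hgood W hW1 hW3
    exact ⟨W, hW3, hW2, h1, hW4, fun w _ =>
      ((norm_greenFn_le_opNorm _ _ _ _).trans h2).trans (by linarith)⟩
  have hU : IsUnit (restrict A Λ) :=
    isUnit_restrict_of_goodSite hA hK hσ0 hσ1 hc₀ hc₁ hc (by linarith) hV hnear hgood'
  refine greenDecay_iff.2 ⟨hU, fun x₀ hx₀ y hy hD => ?_⟩
  obtain ⟨i, ε, hε, hDeq⟩ := exists_coordinate hd x₀ y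
  -- Without bad sites nothing is skipped and no half-space is used, so `E = 0` and `E₁ = 1` are
  -- allowed.
  have hbound := norm_greenFn_le_of_expansions (Λ := Λ) (M := M) (η := η) (Z := ∅) (Bad := ∅)
    (E := 0) (E₁ := 1) hA hK hσ0 hσ1 hη hηc hc₁ hc (B := 2 * E) (by linarith) hV hU
    (abs_coordinate_sub_le hε i) le_rfl zero_le_one (by simp) (by simpa using hsmall)
    (Real.one_le_exp (by positivity)) (fun x hx _ => hgood' x hx)
    (fun x _ h => absurd h (Set.notMem_empty x)) hx₀ hy
  refine le_exp_of_effLength (L := L) (z := 0) hσ0 hσ1 hη hηc (Nat.cast_nonneg _)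
    le_rfl (Nat.cast_nonneg _) hD ?_ (by positivity) ?_ hbound
  · have h1 : ε * x₀ i ≤ ε * y i := by
      have h2 : (0 : ℝ) ≤ ((ε * y i : ℤ) : ℝ) - (ε * x₀ i : ℤ) := by
        rw [← hDeq]; exact norm_nonneg _
      exact_mod_cast sub_nonneg.1 h2
    have h3 := le_effLength_add ∅ h1
    rw [← hDeq] at h3
    simpa using h3
  · rw [Real.zero_rpow hσ0.ne', mul_zero, Real.exp_zero, mul_one, mul_one]
    exact hfin

end step

end MSA

/-! ### Smallness conditions for large `N` -/

namespace MSA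

open Filter

lemma eventually_const_mul_rpow_le {p q : ℝ} (hpq : p < q) (C : ℝ) :
    ∀ᶠ N : ℕ in atTop, C * (N : ℝ) ^ p ≤ (N : ℝ) ^ q := by
  have h1 : Tendsto (fun N : ℕ => (N : ℝ) ^ (q - p)) atTop atTop :=
    (tendsto_rpow_atTop (sub_pos.2 hpq)).comp tendsto_natCast_atTop_atTop
  filter_upwards [h1.eventually_ge_atTop C, eventually_gt_atTop 0] with N hN hN0
  have hx : (0 : ℝ) < N := by exact_mod_cast hN0
  calc C * (N : ℝ) ^ p ≤ (N : ℝ) ^ (q - p) * (N : ℝ) ^ p := by gcongr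
    _ = _ := by rw [← Real.rpow_add hx]; ring_nf

lemma eventually_const_le_rpow {q : ℝ} (hq : 0 < q) (C : ℝ) :
    ∀ᶠ N : ℕ in atTop, C ≤ (N : ℝ) ^ q := by
  filter_upwards [eventually_const_mul_rpow_le hq C] with N hN
  simpa using hN

lemma eventually_log_le_rpow {q : ℝ} (hq : 0 < q) (C : ℝ) :
    ∀ᶠ N : ℕ in atTop, C * Real.log N ≤ (N : ℝ) ^ q := by
  have h1 := ((isLittleO_log_rpow_atTop hq).const_mul_left C).bound one_pos
  filter_upwards [tendsto_natCast_atTop_atTop.eventually h1] with N hN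
  rw [one_mul, Real.norm_eq_abs, Real.norm_eq_abs,
    abs_of_nonneg (Real.rpow_nonneg N.cast_nonneg q)] at hN
  exact (le_abs_self _).trans hN

lemma rpow_le_self_of_one_le {x s : ℝ} (hx : 1 ≤ x) (hs : s ≤ 1) : x ^ s ≤ x := by
  simpa using Real.rpow_le_rpow_of_exponent_le hx hs

lemma div_le_div_rpow {x C s : ℝ} (hx : 0 ≤ x) (hC : 1 ≤ C) (hs : s ≤ 1) :
    x ^ s / C ≤ (x / C) ^ s := by
  rw [Real.div_rpow hx (by linarith)]
  exact div_le_div_of_nonneg_left (by positivity) (by positivity) (rpow_le_self_of_one_le hC hs)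

set_option maxHeartbeats 1000000 in
/-- The smallness conditions of one step of the multi-scale analysis hold for large `N`. -/
theorem exists_forall_step_conditions {σ σ' a a' b κ ϑ K c₁ c₀ : ℝ} (d : ℕ) (hσ0 : 0 < σ')
    (hσ1 : σ' ≤ 1) (ha : 0 < a) (haa : a < a') (ha' : a' ≤ 1) (hϑ : 0 < ϑ)
    (hb : b * σ + ϑ < a * σ') (hϑa : ϑ < σ' * (a' - a)) (hϑκ : ϑ < σ' * κ) (hK : 0 < K)
    (hc₁ : 0 < c₁) (hc₀ : 0 < c₀) (hbσ : 0 ≤ b * σ) :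
    ∃ N₀ : ℕ, ∀ N : ℕ, N₀ ≤ N → ∀ (c E : ℝ) (L M : ℕ), c₀ ≤ c → c ≤ c₁ →
      M = ⌊(N : ℝ) ^ a⌋₊ → (N : ℝ) ^ a' / 2 ≤ L → (L : ℝ) ≤ (N : ℝ) ^ a' →
      1 ≤ E → E ≤ Real.exp (2 * (N : ℝ) ^ (b * σ)) →
      ∀ η V E₁ T : ℝ, η = (N : ℝ) ^ (-ϑ) → V = ((2 * L + 1 : ℕ) : ℝ) ^ d →
      E₁ = 2 * V ^ 2 * max 1 K * E → T = (N : ℝ) ^ (a' - κ - a) →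
      1 ≤ M ∧ 2 * M + 3 ≤ L ∧ η ≤ c ∧
      V ^ 2 * (2 * E) * K * Real.exp (-c * ((M : ℝ) / 2) ^ σ') ≤ 1 / 2 ∧
      1 ≤ E₁ ∧ E ≤ E₁ ∧ 2 * V ^ 2 * K * E ≤ E₁ ∧
      2 * V ^ 2 * (2 * E) * K * E₁ ≤ Real.exp (η * ((M : ℝ) / 2) ^ σ') ∧
      E₁ ≤ Real.exp (η * (M : ℝ) ^ σ') ∧
      2 * (2 * E) * E₁ * Real.exp (c * (M : ℝ) ^ σ') *
        Real.exp (c * (T * (10 * M + 1) + (6 * M + 12)) ^ σ') ≤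
          Real.exp (η * ((L : ℝ) / 10) ^ σ') := by
  set p := a * σ' - ϑ with hp
  have hp0 : b * σ < p := by linarith
  have hp1 : 0 < p := by linarith
  have hq : a * σ' < a' * σ' - ϑ := by linarith
  have hq2 : (a' - κ) * σ' < a' * σ' - ϑ := by linarith
  -- The factors `64` and `128` anticipate `y / 16 ≥ N^p / 64` below; the two factors `40` split the
  -- final bound `N^(a'σ'-ϑ) / 20` evenly between the scale `M` and the size of `Z`.
  have hev := (eventually_ge_atTop 1).and <| (eventually_const_le_rpow ha 2).and <|
    (eventually_const_mul_rpow_le haa 10).and <| (eventually_const_le_rpow hϑ (1 / c₀)).and <|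
    (eventually_const_mul_rpow_le hp0 128).and <|
    (eventually_log_le_rpow hp1 (128 * d)).and <|
    (eventually_const_le_rpow hp1 (128 * d * Real.log 3)).and <|
    (eventually_const_le_rpow hp1 (64 * Real.log (max 1 K))).and <|
    (eventually_const_le_rpow hp1 (64 * Real.log 4)).and <|
    (eventually_const_mul_rpow_le hq (40 * (1 + 19 * c₁))).and
    (eventually_const_mul_rpow_le hq2 (40 * (11 * c₁)))
  obtain ⟨N₀, hN₀⟩ := eventually_atTop.1 hev
  refine ⟨N₀, fun N hN c E L M hcc hc hM hL1 hL2 hE1 hE2 η V E₁ T hη hV hE₁ hT => ?_⟩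
  obtain ⟨f1, f2, f3, f4, f5, f6, f7, f8, f9, f10, f11⟩ := hN₀ N hN
  set x : ℝ := (N : ℝ) with hx
  have hx1 : 1 ≤ x := by rw [hx]; exact_mod_cast f1
  have hx0 : 0 < x := by linarith
  have hMle : (M : ℝ) ≤ x ^ a := by rw [hM]; exact Nat.floor_le (by positivity)
  have hMge : x ^ a / 2 ≤ M := by
    have := Nat.lt_floor_add_one (x ^ a)
    rw [← hM] at this
    linarith
  have hM1 : 1 ≤ M := by
    have : (1 : ℝ) ≤ M := by linarith
    exact_mod_cast this
  have hM1' : (1 : ℝ) ≤ M := by exact_mod_cast hM1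
  have hML : 2 * M + 3 ≤ L := by
    have : (2 * M + 3 : ℝ) ≤ L := by linarith
    exact_mod_cast this
  have hη0 : 0 < η := by rw [hη]; positivity
  have hη1 : η ≤ 1 := by
    rw [hη]; exact Real.rpow_le_one_of_one_le_of_nonpos hx1 (by linarith)
  have hηc : η ≤ c := by
    rw [hη, Real.rpow_neg hx0.le]
    refine le_trans ?_ hcc
    rw [inv_le_comm₀ (by positivity) hc₀]
    simpa using f4
  have hc0 : 0 < c := hη0.trans_le hηc
  set y := η * ((M : ℝ) / 2) ^ σ' with hy
  have hy_ge : x ^ p / 4 ≤ y := by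
    have h1 : (x ^ a / 4) ^ σ' ≤ ((M : ℝ) / 2) ^ σ' :=
      Real.rpow_le_rpow (by positivity) (by linarith) hσ0.le
    have h2 : (x ^ a) ^ σ' / 4 ≤ (x ^ a / 4) ^ σ' :=
      div_le_div_rpow (by positivity) (by norm_num) hσ1
    calc x ^ p / 4 = η * ((x ^ a) ^ σ' / 4) := by
          rw [hη, ← Real.rpow_mul hx0.le, hp, sub_eq_neg_add, Real.rpow_add hx0]; ring
      _ ≤ y := by rw [hy]; gcongr; exact h2.trans h1
  -- Each of `4`, `max 1 K`, `E` and `V` is at most `t`, so every prefactor is bounded by a power of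
  -- `t` below the sixteenth, which is the available gain `exp y`.
  set t := Real.exp (y / 16) with ht
  have ht0 : 0 < t := Real.exp_pos _
  have ht16 : t ^ 16 = Real.exp y := by
    rw [ht, ← Real.exp_nat_mul]; congr 1; push_cast; ring
  have h4t : 4 ≤ t := by
    rw [ht, ← Real.log_le_iff_le_exp (by norm_num)]; linarith
  have ht1 : 1 ≤ t := by linarith
  have hKt : max 1 K ≤ t := by
    rw [ht, ← Real.log_le_iff_le_exp (by positivity)]; linarith
  have hEt : E ≤ t := hE2.trans (Real.exp_le_exp.2 (by linarith))
  have hV1 : 1 ≤ V := by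
    rw [hV]; exact one_le_pow₀ (by push_cast; linarith [Nat.cast_nonneg (α := ℝ) L])
  have hVt : V ≤ t := by
    have h1 : ((2 * L + 1 : ℕ) : ℝ) ≤ 3 * x := by
      have h2 : x ^ a' ≤ x := rpow_le_self_of_one_le hx1 ha'
      push_cast; linarith
    have h2 : V ≤ (3 * x) ^ d := by rw [hV]; gcongr
    refine h2.trans ?_
    rw [ht, ← Real.log_le_iff_le_exp (by positivity), Real.log_pow,
      Real.log_mul (by norm_num) hx0.ne', mul_add]
    linarith only [f6, f7, hy_ge]
  have hKle : K ≤ max 1 K := le_max_right _ _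
  have hK1 : 1 ≤ max 1 K := le_max_left _ _
  set k := max 1 K
  have hE0 : 0 < E := by linarith
  have hk0 : 0 < k := by linarith
  have hV0 : 0 < V := by linarith
  have hE₁le : E₁ ≤ t ^ 5 := by
    calc E₁ = 2 * V ^ 2 * k * E := hE₁
      _ ≤ t * t ^ 2 * t * t := by gcongr; linarith
      _ = t ^ 5 := by ring
  have hEE : E ≤ E₁ := by
    rw [hE₁]
    refine le_mul_of_one_le_left hE0.le ?_
    have : 1 ≤ V ^ 2 := one_le_pow₀ hV1
    nlinarith
  have hE₁1 : 1 ≤ E₁ := hE1.trans hEE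
  have hMσ : y ≤ η * (M : ℝ) ^ σ' := by
    rw [hy]; gcongr; linarith
  refine ⟨hM1, hML, hηc, ?_, hE₁1, hEE, ?_, ?_, ?_, ?_⟩
  · have h1 : -c * ((M : ℝ) / 2) ^ σ' ≤ -y := by
      rw [hy, neg_mul, neg_le_neg_iff]; gcongr
    calc V ^ 2 * (2 * E) * K * Real.exp (-c * ((M : ℝ) / 2) ^ σ')
        ≤ t ^ 2 * (t * t) * t * Real.exp (-y) := by
          gcongr
          · linarith
          · linarith
      _ = t ^ 5 * (t ^ 16)⁻¹ := by rw [ht16, Real.exp_neg]; ring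
      _ = (t ^ 11)⁻¹ := by field_simp
      _ ≤ t⁻¹ := by
          refine inv_anti₀ ht0 (le_self_pow₀ ht1 (by norm_num))
      _ ≤ 2⁻¹ := inv_anti₀ (by norm_num) (by linarith)
      _ = 1 / 2 := by norm_num
  · rw [hE₁]; gcongr
  · calc 2 * V ^ 2 * (2 * E) * K * E₁ ≤ t * t ^ 2 * (t * t) * t * t ^ 5 := by
          gcongr
          · linarith
          · linarith
          · linarith
      _ = t ^ 11 := by ring
      _ ≤ t ^ 16 := pow_le_pow_right₀ ht1 (by norm_num)
      _ = _ := ht16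
  · calc E₁ ≤ t ^ 5 := hE₁le
      _ ≤ t ^ 16 := pow_le_pow_right₀ ht1 (by norm_num)
      _ = Real.exp y := ht16
      _ ≤ _ := Real.exp_le_exp.2 hMσ
  · have hpre : 2 * (2 * E) * E₁ ≤ Real.exp y := by
      calc 2 * (2 * E) * E₁ = 4 * E * E₁ := by ring
        _ ≤ t * t * t ^ 5 := by gcongr
        _ = t ^ 7 := by ring
        _ ≤ t ^ 16 := pow_le_pow_right₀ ht1 (by norm_num)
        _ = _ := ht16
    have hMσ' : (M : ℝ) ^ σ' ≤ x ^ (a * σ') := by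
      rw [Real.rpow_mul hx0.le]; exact Real.rpow_le_rpow (by positivity) hMle hσ0.le
    have hyM : y ≤ x ^ (a * σ') := by
      refine hMσ.trans (le_trans ?_ hMσ')
      exact mul_le_of_le_one_left (by positivity) hη1
    have hT0 : 0 < T := by rw [hT]; positivity
    have hz : T * (10 * M + 1) + (6 * M + 12) ≤ 11 * x ^ (a' - κ) + 18 * x ^ a := by
      have h1 : T * (10 * M + 1) ≤ T * (11 * x ^ a) := by gcongr; linarith
      have h2 : T * (11 * x ^ a) = 11 * x ^ (a' - κ) := by
        have : x ^ (a' - κ - a) * x ^ a = x ^ (a' - κ) := by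
          rw [← Real.rpow_add hx0]; ring_nf
        rw [hT, ← this]; ring
      linarith
    have hzσ : (T * (10 * M + 1) + (6 * M + 12)) ^ σ'
        ≤ 11 * x ^ ((a' - κ) * σ') + 18 * x ^ (a * σ') := by
      calc (T * (10 * M + 1) + (6 * M + 12)) ^ σ'
          ≤ (11 * x ^ (a' - κ)) ^ σ' + (18 * x ^ a) ^ σ' :=
            rpow_le_rpow_add_of_le_add (by positivity) (by positivity) (by positivity) hσ0.le
              hσ1 hz
        _ = (11 : ℝ) ^ σ' * x ^ ((a' - κ) * σ') + (18 : ℝ) ^ σ' * x ^ (a * σ') := by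
            rw [Real.mul_rpow (by norm_num) (by positivity),
              Real.mul_rpow (by norm_num) (by positivity), ← Real.rpow_mul hx0.le,
              ← Real.rpow_mul hx0.le]
        _ ≤ _ := by
            gcongr
            · exact rpow_le_self_of_one_le (by norm_num) hσ1
            · exact rpow_le_self_of_one_le (by norm_num) hσ1
    have hLσ : x ^ (a' * σ' - ϑ) / 20 ≤ η * ((L : ℝ) / 10) ^ σ' := by
      have h1 : (x ^ a' / 20) ^ σ' ≤ ((L : ℝ) / 10) ^ σ' :=
        Real.rpow_le_rpow (by positivity) (by linarith) hσ0.le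
      have h2 : (x ^ a') ^ σ' / 20 ≤ (x ^ a' / 20) ^ σ' :=
        div_le_div_rpow (by positivity) (by norm_num) hσ1
      calc x ^ (a' * σ' - ϑ) / 20 = η * ((x ^ a') ^ σ' / 20) := by
            rw [hη, ← Real.rpow_mul hx0.le, sub_eq_neg_add, Real.rpow_add hx0]; ring
        _ ≤ _ := by gcongr; exact h2.trans h1
    calc 2 * (2 * E) * E₁ * Real.exp (c * (M : ℝ) ^ σ') *
        Real.exp (c * (T * (10 * M + 1) + (6 * M + 12)) ^ σ')
        ≤ Real.exp y * Real.exp (c₁ * x ^ (a * σ')) *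
          Real.exp (c₁ * (11 * x ^ ((a' - κ) * σ') + 18 * x ^ (a * σ'))) := by
          gcongr
      _ = Real.exp (y + c₁ * x ^ (a * σ') +
          c₁ * (11 * x ^ ((a' - κ) * σ') + 18 * x ^ (a * σ'))) := by
          rw [Real.exp_add, Real.exp_add]
      _ ≤ _ := Real.exp_le_exp.2 (by linarith)

end MSA

/-! ### Counting bad regions along the scales -/

namespace MSA

open Filter

variable {d : ℕ}

/-- The bound `exp(L^σ)` for inverses on the wide regions in `Λ₀` of diameter at most `L`. -/
def NormBound (A : Matrix (Fin d → ℤ) (Fin d → ℤ) ℂ) (σ ξ : ℝ) (N : ℕ)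
    (Λ₀ : Finset (Fin d → ℤ)) : Prop :=
  ∀ L : ℝ, (N : ℝ) ^ ξ ≤ L → L ≤ (N : ℝ) → ∀ Λ ∈ wideRegions d L ((N : ℝ) ^ ξ), Λ ⊆ Λ₀ →
    IsUnit (restrict A Λ) ∧ opNorm (green A Λ) ≤ Real.exp (L ^ σ)

/-- Disjoint families of elementary regions of size `N ^ a` in `Λ₀` without decay of the Green's
function have at most `N ^ (s - a)` members. -/
def BadCount (A : Matrix (Fin d → ℤ) (Fin d → ℤ) ℂ) (c σ' a s : ℝ) (N : ℕ)
    (Λ₀ : Finset (Fin d → ℤ)) : Prop :=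
  ∀ F : Finset (Finset (Fin d → ℤ)),
    (∀ W ∈ F, W ∈ elementaryRegions d ⌊(N : ℝ) ^ a⌋₊ ∧ W ⊆ Λ₀ ∧
      ¬ GreenDecay A c σ' ⌊(N : ℝ) ^ a⌋₊ W) →
    (∀ W ∈ F, ∀ W' ∈ F, W ≠ W' → Disjoint W W') → (F.card : ℝ) ≤ (N : ℝ) ^ (s - a)

lemma two_mul_rpow_le {x L a σ : ℝ} (hx : 0 ≤ x) (hL0 : 0 ≤ L) (hL : L ≤ x ^ a) (hσ0 : 0 ≤ σ)
    (hσ1 : σ ≤ 1) : (2 * L) ^ σ ≤ 2 * x ^ (a * σ) := by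
  rw [Real.mul_rpow (by norm_num) hL0, Real.rpow_mul hx]
  have h1 : (2 : ℝ) ^ σ ≤ 2 := rpow_le_self_of_one_le (by norm_num) hσ1
  have h2 : L ^ σ ≤ (x ^ a) ^ σ := Real.rpow_le_rpow hL0 hL hσ0
  gcongr

lemma half_le_floor {r : ℝ} (hr : 2 ≤ r) : r / 2 ≤ (⌊r⌋₊ : ℝ) := by
  have := Nat.lt_floor_add_one r
  linarith

/-- The passage from the scale `N ^ a` to the scale `N ^ a'`. -/
theorem exists_forall_badCount_step {σ σ' ξ a a' κ ϑ K c₁ c₀ : ℝ} (hd : 1 ≤ d)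
    (hσ : 0 < σ) (hσ1 : σ ≤ 1) (hσ0' : 0 < σ') (hσ1' : σ' ≤ 1) (hξ : 0 < ξ) (hξa : ξ ≤ a)
    (haa : a < a') (ha' : a' < 1) (hϑ : 0 < ϑ) (hb : a' * σ + ϑ < a * σ')
    (hϑa : ϑ < σ' * (a' - a)) (hϑκ : ϑ < σ' * κ) (hK : 0 < K) (hc₁ : 0 < c₁) (hc₀ : 0 < c₀) :
    ∃ N₀ : ℕ, ∀ N : ℕ, N₀ ≤ N → ∀ (c s : ℝ) (A : Matrix (Fin d → ℤ) (Fin d → ℤ) ℂ)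
      (Λ₀ : Finset (Fin d → ℤ)), c₀ ≤ c → c ≤ ((5 : ℝ) ^ σ' - 1) / (5 : ℝ) ^ σ' * c₁ →
      SubexpDecay A K c₁ σ' → NormBound A σ ξ N Λ₀ → BadCount A c σ' a s N Λ₀ →
      BadCount A (c - 2 * (N : ℝ) ^ (-ϑ)) σ' a' (s + κ) N Λ₀ := by
  classical
  have ha : 0 < a := hξ.trans_le hξa
  obtain ⟨N₁, hN₁⟩ := exists_forall_step_conditions (b := a') d hσ0' hσ1' ha haa ha'.le hϑ hb hϑa
    hϑκ hK hc₁ hc₀ (by have := ha.trans haa; positivity)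
  obtain ⟨N₂, hN₂⟩ := eventually_atTop.1 ((eventually_ge_atTop 1).and
    ((eventually_const_le_rpow (ha.trans haa) 2).and (eventually_const_mul_rpow_le ha' 2)))
  refine ⟨max N₁ N₂, fun N hN c s A Λ₀ hcc hc hA hnorm hbad F hF hFd => ?_⟩
  obtain ⟨hN1, h2, h3⟩ := hN₂ N ((le_max_right _ _).trans hN)
  have hx1 : (1 : ℝ) ≤ N := by exact_mod_cast hN1
  have hx0 : (0 : ℝ) < N := one_pos.trans_le hx1
  rw [Real.rpow_one] at h3
  set M := ⌊(N : ℝ) ^ a⌋₊ with hM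
  set L := ⌊(N : ℝ) ^ a'⌋₊ with hL
  have hLle : (L : ℝ) ≤ (N : ℝ) ^ a' := Nat.floor_le (by positivity)
  set E := Real.exp ((2 * L : ℝ) ^ σ) with hE
  have hE1 : 1 ≤ E := Real.one_le_exp (by positivity)
  obtain ⟨g1, g2, g3, g4, g5, g6, g7, g8, g9, g10⟩ := hN₁ N ((le_max_left _ _).trans hN) c E L M
    hcc (rate_le hc₁.le hc) hM (half_le_floor h2) hLle hE1
    (Real.exp_le_exp.2 (two_mul_rpow_le hx0.le (by positivity) hLle hσ.le hσ1))
    _ _ _ _ rfl rfl rfl rfl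
  -- Rounding down may put `M` below `N^ξ`; this is why the one-step theorem asks for width `M + 1`.
  have hξM : (N : ℝ) ^ ξ ≤ (M + 1 : ℕ) := by
    refine (Real.rpow_le_rpow_of_exponent_le hx1 hξa).trans ?_
    push_cast
    exact (Nat.lt_floor_add_one _).le
  have key : ∀ Λ ∈ F, ∃ G : Finset (Finset (Fin d → ℤ)),
      (∀ W ∈ G, W ∈ elementaryRegions d M ∧ W ⊆ Λ ∧ ¬ GreenDecay A c σ' M W) ∧
      (∀ W ∈ G, ∀ W' ∈ G, W ≠ W' → Disjoint W W') ∧ (N : ℝ) ^ (a' - κ - a) < G.card := by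
    intro Λ hΛ
    obtain ⟨hΛE, hΛ0, hΛbad⟩ := hF Λ hΛ
    -- If no such large family existed, the one-step theorem would apply to `Λ` and contradict its
    -- being bad.
    by_contra! hcon
    refine hΛbad (greenDecay_of_few_bad hd hA hK.le hσ0' hσ1' (by positivity) g3 hc₁.le hc g1 g2
      hΛE hE1 (fun S hS hSΛ => ?_) hcon
      (by exact_mod_cast card_le_of_mem_elementaryRegions hΛE) ?_ g5 g6 g7 g8 g9 g10)
    · refine hnorm (2 * L) ?_ (by linarith) S ⟨hS.1, hS.2.1, hξM.trans hS.2.2⟩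
        (hSΛ.trans hΛ0)
      refine hξM.trans ?_
      have : M + 1 ≤ 2 * L := by omega
      exact_mod_cast this
    · have h4 : ∀ v q : ℝ, v * K * E * q = v * (2 * E) * K * q / 2 := fun v q => by ring
      rw [h4]
      linarith
  choose! G hG1 hG2 hG3 using key
  have hdisj : ∀ Λ ∈ F, ∀ Λ' ∈ F, Λ ≠ Λ' → Disjoint (G Λ) (G Λ') := by
    intro Λ hΛ Λ' hΛ' hne
    refine Finset.disjoint_left.2 fun W hW hW' => ?_
    obtain ⟨n, hn⟩ := elementaryRegions_nonempty (hG1 Λ hΛ W hW).1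
    exact Finset.disjoint_left.1 (hFd Λ hΛ Λ' hΛ' hne) ((hG1 Λ hΛ W hW).2.1 hn)
      ((hG1 Λ' hΛ' W hW').2.1 hn)
  have hcount := hbad (F.biUnion G)
    (fun W hW => by
      obtain ⟨Λ, hΛ, hWΛ⟩ := Finset.mem_biUnion.1 hW
      obtain ⟨h4, h5, h6⟩ := hG1 Λ hΛ W hWΛ
      exact ⟨h4, h5.trans (hF Λ hΛ).2.1, h6⟩)
    (fun W hW W' hW' hne => by
      obtain ⟨Λ, hΛ, hWΛ⟩ := Finset.mem_biUnion.1 hW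
      obtain ⟨Λ', hΛ', hWΛ'⟩ := Finset.mem_biUnion.1 hW'
      by_cases h : Λ = Λ'
      · subst h
        exact hG2 Λ hΛ W hWΛ W' hWΛ' hne
      · exact Finset.disjoint_of_subset_left (hG1 Λ hΛ W hWΛ).2.1
          (Finset.disjoint_of_subset_right (hG1 Λ' hΛ' W' hWΛ').2.1 (hFd Λ hΛ Λ' hΛ' h)))
  rw [Finset.card_biUnion hdisj] at hcount
  push_cast at hcount
  have hsum : (F.card : ℝ) * (N : ℝ) ^ (a' - κ - a) ≤ ∑ Λ ∈ F, ((G Λ).card : ℝ) := by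
    rw [← nsmul_eq_mul, ← Finset.sum_const]
    exact Finset.sum_le_sum fun Λ hΛ => (hG3 Λ hΛ).le
  have hpos : 0 < (N : ℝ) ^ (a' - κ - a) := by positivity
  have hfin := hsum.trans hcount
  rw [← le_div_iff₀ hpos, ← Real.rpow_sub hx0] at hfin
  rwa [show s + κ - a' = s - a - (a' - κ - a) by ring]

/-- The passage from a scale without bad regions to the scale `N`. -/
theorem exists_forall_greenDecay_of_badCount {σ σ' ξ a s ϑ K c₁ c₀ : ℝ} (hd : 1 ≤ d)
    (hσ : 0 < σ) (hσ1 : σ ≤ 1) (hσ0' : 0 < σ') (hσ1' : σ' ≤ 1) (hξ : 0 < ξ) (hξa : ξ < a)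
    (ha1 : a < 1) (hs : s < a) (hϑ : 0 < ϑ) (hb : a * σ + ϑ < a * σ')
    (hϑa : ϑ < σ' * (1 - a)) (hK : 0 < K) (hc₁ : 0 < c₁) (hc₀ : 0 < c₀) :
    ∃ N₀ : ℕ, ∀ N : ℕ, N₀ ≤ N → ∀ (c : ℝ) (A : Matrix (Fin d → ℤ) (Fin d → ℤ) ℂ),
      ∀ Λ₀ ∈ elementaryRegions d N, c₀ ≤ c → c ≤ ((5 : ℝ) ^ σ' - 1) / (5 : ℝ) ^ σ' * c₁ →
      SubexpDecay A K c₁ σ' → NormBound A σ ξ N Λ₀ → BadCount A c σ' a s N Λ₀ →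
      GreenDecay A (c - 2 * (N : ℝ) ^ (-ϑ)) σ' N Λ₀ := by
  classical
  have ha : 0 < a := hξ.trans hξa
  -- Inverses are needed only on regions of the smaller scale, hence `b = a`. No skipped set occurs,
  -- and `κ = 1 - a` reduces its condition to the one on the gap between the scales.
  obtain ⟨N₁, hN₁⟩ := exists_forall_step_conditions (b := a) (κ := 1 - a) d hσ0' hσ1' ha ha1
    le_rfl hϑ hb hϑa hϑa hK hc₁ hc₀ (by positivity)
  obtain ⟨N₂, hN₂⟩ := eventually_atTop.1 ((eventually_ge_atTop 2).and
    ((eventually_const_mul_rpow_le hξa 2).and ((eventually_const_mul_rpow_le ha1 2).and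
      (eventually_const_le_rpow ha 2))))
  refine ⟨max N₁ N₂, fun N hN c A Λ₀ hΛ₀ hcc hc hA hnorm hbad => ?_⟩
  obtain ⟨hN2, h2, h3, h4⟩ := hN₂ N ((le_max_right _ _).trans hN)
  have hx1 : (1 : ℝ) < N := by exact_mod_cast hN2
  have hx0 : (0 : ℝ) < N := one_pos.trans hx1
  rw [Real.rpow_one] at h3
  set M := ⌊(N : ℝ) ^ a⌋₊ with hM
  have hMle : (M : ℝ) ≤ (N : ℝ) ^ a := Nat.floor_le (by positivity)
  have hξM : (N : ℝ) ^ ξ ≤ M := by linarith [half_le_floor h4]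
  set E := Real.exp ((2 * M : ℝ) ^ σ) with hE
  have hE1 : 1 ≤ E := Real.one_le_exp (by positivity)
  obtain ⟨g1, g2, g3, g4, g5, g6, g7, g8, g9, g10⟩ := hN₁ N ((le_max_left _ _).trans hN) c E N M
    hcc (rate_le hc₁.le hc) hM (by rw [Real.rpow_one]; linarith) (by rw [Real.rpow_one]) hE1
    (Real.exp_le_exp.2 (two_mul_rpow_le hx0.le (by positivity) hMle hσ.le hσ1))
    _ _ _ _ rfl rfl rfl rfl
  refine greenDecay_of_no_bad hd hA hK.le hσ0' hσ1' (by positivity) g3 hc₁.le hc (by omega)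
    hΛ₀ hE1 (fun W hW hWΛ => ⟨?_, ?_⟩)
    (by exact_mod_cast card_le_of_mem_elementaryRegions hΛ₀) g4 ?_ ?_
  · by_contra hcon
    -- A single bad region would already exceed the bound, which is below `1`.
    have h5 := hbad {W} (by simpa using ⟨hW, hWΛ, hcon⟩) (by simp)
    have h6 : (N : ℝ) ^ (s - a) < 1 := Real.rpow_lt_one_of_one_lt_of_neg hx1 (by linarith)
    simp only [Finset.card_singleton, Nat.cast_one] at h5
    linarith
  · exact (hnorm (2 * M) (by linarith) (by linarith) W
      (mem_wideRegions_of_mem_elementaryRegions hd hW hξM) hWΛ).2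
  · refine le_trans (le_mul_of_one_le_right ?_ g5) g8
    positivity
  · refine le_trans ?_ g10
    have h5 : 1 ≤ Real.exp (c * ((N : ℝ) ^ ((1 : ℝ) - (1 - a) - a) * (10 * M + 1) +
        (6 * M + 12)) ^ σ') := Real.one_le_exp (by have := hc₀.trans_le hcc; positivity)
    refine le_trans ?_ (le_mul_of_one_le_right (by positivity) h5)
    refine mul_le_mul_of_nonneg_right ?_ (Real.exp_pos _).le
    exact le_mul_of_one_le_right (by positivity) g5

/-- The number of bad regions at the scales `N ^ (ξ + k δ)`. -/
theorem exists_forall_badCount {σ σ' ξ ς δ κ ϑ K c₁ c₀ : ℝ} (hd : 1 ≤ d)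
    (hσ : 0 < σ) (hσ1 : σ ≤ 1) (hσ0' : 0 < σ') (hσ1' : σ' ≤ 1) (hξ : 0 < ξ) (hδ : 0 < δ)
    (hϑ : 0 < ϑ) (hb : δ + ϑ < ξ * (σ' - σ))
    (hϑδ : ϑ < σ' * δ) (hϑκ : ϑ < σ' * κ) (hσσ' : σ < σ') (hK : 0 < K) (hc₁ : 0 < c₁)
    (hc₀ : 0 < c₀) (k : ℕ) (hk : ξ + k * δ < 1) :
    ∃ N₀ : ℕ, ∀ N : ℕ, N₀ ≤ N → ∀ (c₂ : ℝ) (A : Matrix (Fin d → ℤ) (Fin d → ℤ) ℂ)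
      (Λ₀ : Finset (Fin d → ℤ)), c₀ + 2 * k * (N : ℝ) ^ (-ϑ) ≤ c₂ →
      c₂ ≤ ((5 : ℝ) ^ σ' - 1) / (5 : ℝ) ^ σ' * c₁ →
      SubexpDecay A K c₁ σ' → NormBound A σ ξ N Λ₀ → BadCount A c₂ σ' ξ ς N Λ₀ →
      BadCount A (c₂ - 2 * k * (N : ℝ) ^ (-ϑ)) σ' (ξ + k * δ) (ς + k * κ) N Λ₀ := by
  induction k with
  | zero =>
    refine ⟨0, fun N _ c₂ A Λ₀ _ _ _ _ h => ?_⟩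
    simpa using h
  | succ k ih =>
    push_cast at hk
    obtain ⟨N₁, hN₁⟩ := ih (by linarith)
    have hkδ : 0 ≤ k * δ := by positivity
    -- The condition `a' σ + ϑ < a σ'` persists along the scales because `a (σ' - σ) ≥ ξ (σ' - σ) >
    -- δ + ϑ`.
    obtain ⟨N₂, hN₂⟩ := exists_forall_badCount_step (d := d) (ξ := ξ) (a := ξ + k * δ)
      (a' := ξ + (k + 1) * δ) (κ := κ) (K := K) hd hσ hσ1 hσ0' hσ1' hξ (by linarith)
      (by linarith) hk hϑ (by nlinarith) (by linarith) hϑκ hK hc₁ hc₀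
    refine ⟨max N₁ N₂, fun N hN c₂ A Λ₀ hc hc' hA hnorm hbad => ?_⟩
    push_cast at hc ⊢
    have hη : 0 ≤ (N : ℝ) ^ (-ϑ) := by positivity
    have hkη : 0 ≤ 2 * k * (N : ℝ) ^ (-ϑ) := by positivity
    have h1 := hN₁ N ((le_max_left _ _).trans hN) c₂ A Λ₀ (by linarith) hc' hA hnorm hbad
    have h2 := hN₂ N ((le_max_right _ _).trans hN) _ _ A Λ₀ (by linarith) (by linarith) hA
      hnorm h1
    convert h2 using 1 <;> ring

end MSA

/-! ### Choice of the exponents and conclusion -/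

theorem theorem2p1 (σ σ' ξ ς : ℝ) (hσ : 0 < σ) (hσσ' : σ < σ') (hσ' : σ' ≤ 1)
    (hξ : 0 < ξ) (hξ1 : ξ < 1) (hς : 0 < ς) (hς1 : ς < 1) :
    ∃ ϑ : ℝ, 0 < ϑ ∧
      ∀ (d : ℕ), 1 ≤ d → ∀ (K c₁ c₀ : ℝ), 0 < K → 0 < c₁ → 0 < c₀ →
        ∃ N₀ : ℕ, ∀ (c₂ : ℝ), c₀ ≤ c₂ → c₂ ≤ ((5 : ℝ) ^ σ' - 1) / (5 : ℝ) ^ σ' * c₁ →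
          ∀ (A : Matrix (Fin d → ℤ) (Fin d → ℤ) ℂ), MSA.SubexpDecay A K c₁ σ' →
          ∀ (N : ℕ), N₀ ≤ N → ∀ Λ₀ ∈ MSA.elementaryRegions d N,
            (∀ L : ℝ, (N : ℝ) ^ ξ ≤ L → L ≤ (N : ℝ) →
              ∀ Λ ∈ MSA.wideRegions d L ((N : ℝ) ^ ξ), Λ ⊆ Λ₀ →
                IsUnit (MSA.restrict A Λ) ∧
                  MSA.opNorm (MSA.green A Λ) ≤ Real.exp (L ^ σ)) →
            (∀ F : Finset (Finset (Fin d → ℤ)),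
              (∀ Λ ∈ F, Λ ∈ MSA.elementaryRegions d ⌊(N : ℝ) ^ ξ⌋₊ ∧ Λ ⊆ Λ₀) →
              (∀ Λ ∈ F, ∀ Λ' ∈ F, Λ ≠ Λ' → Disjoint Λ Λ') →
                ({Λ ∈ (F : Set (Finset (Fin d → ℤ))) |
                    ¬ MSA.GreenDecay A c₂ σ' ⌊(N : ℝ) ^ ξ⌋₊ Λ}.ncard : ℝ)
                  ≤ (N : ℝ) ^ ς / (N : ℝ) ^ ξ) →
            MSA.GreenDecay A (c₂ - (N : ℝ) ^ (-ϑ)) σ' N Λ₀ := by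
  set a : ℝ := (1 + max ξ ς) / 2 with ha
  have hmax : max ξ ς < 1 := max_lt hξ1 hς1
  have hξa : ξ < a := by rw [ha]; linarith [le_max_left ξ ς]
  have hςa : ς < a := by rw [ha]; linarith [le_max_right ξ ς]
  have ha1 : a < 1 := by rw [ha]; linarith
  have hσ0' : 0 < σ' := hσ.trans hσσ'
  have hgap : 0 < ξ * (σ' - σ) := mul_pos hξ (sub_pos.2 hσσ')
  -- The number of steps `n` is fixed so that `δ < ξ(σ'-σ)/2`; the other half is left for `ϑ`. After
  -- `n` steps the scale exponent is `a`, and the count exponent `ς + nκ = (a + ς)/2` is still below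
  -- it.
  obtain ⟨n, hn⟩ := exists_nat_gt (2 * (a - ξ) / (ξ * (σ' - σ)))
  have hn0 : (0 : ℝ) < n := lt_of_le_of_lt (by have := hξa.le; positivity) hn
  set δ : ℝ := (a - ξ) / n with hδdef
  set κ : ℝ := (a - ς) / (2 * n) with hκdef
  have hδ : 0 < δ := div_pos (by linarith) hn0
  have hκ : 0 < κ := div_pos (by linarith) (by linarith)
  have hnδ : ξ + n * δ = a := by rw [hδdef]; field_simp; ring
  have hnκ : ς + n * κ < a := by
    have : n * κ = (a - ς) / 2 := by rw [hκdef]; field_simp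
    linarith
  have hδle : δ < ξ * (σ' - σ) / 2 := by
    rw [div_lt_iff₀ hgap] at hn
    rw [hδdef, div_lt_iff₀ hn0]
    linarith
  obtain ⟨ϑ, hϑ, h1, h2, h3, h4⟩ : ∃ ϑ : ℝ, 0 < ϑ ∧ ϑ < ξ * (σ' - σ) / 2 ∧ ϑ < σ' * δ ∧
      ϑ < σ' * κ ∧ ϑ < σ' * (1 - a) := by
    have hpos : 0 < min (min (ξ * (σ' - σ) / 2) (σ' * δ)) (min (σ' * κ) (σ' * (1 - a))) :=
      lt_min (lt_min (by linarith) (by positivity))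
        (lt_min (by positivity) (mul_pos hσ0' (by linarith)))
    obtain ⟨ϑ, h1, h2⟩ := exists_between hpos
    simp only [lt_min_iff] at h2
    exact ⟨ϑ, h1, h2.1.1, h2.1.2, h2.2.1, h2.2.2⟩
  -- The total loss is `(2n + 2) N^(-ϑ)`, which is below `N^(-ϑ/2)` for large `N`. The rate stays
  -- above `c₀ / 2` throughout, so the lemmas are used with that constant.
  refine ⟨ϑ / 2, by linarith, fun d hd K c₁ c₀ hK hc₁ hc₀ => ?_⟩
  obtain ⟨N₁, hN₁⟩ := MSA.exists_forall_badCount (d := d) (ς := ς) (κ := κ) (K := K) (c₀ := c₀ / 2)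
    hd hσ (hσσ'.le.trans hσ') hσ0' hσ' hξ hδ hϑ (by linarith) h2 h3 hσσ' hK hc₁ (by linarith) n
    (by rw [hnδ]; exact ha1)
  have haσ : ξ * (σ' - σ) ≤ a * (σ' - σ) := by
    have : 0 ≤ σ' - σ := by linarith
    gcongr
  obtain ⟨N₂, hN₂⟩ := MSA.exists_forall_greenDecay_of_badCount (d := d) (s := ς + n * κ) (K := K)
    (c₀ := c₀ / 2) hd hσ (hσσ'.le.trans hσ') hσ0' hσ' hξ hξa ha1 hnκ hϑ (by linarith) h4 hK hc₁
    (by linarith)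
  obtain ⟨N₃, hN₃⟩ := Filter.eventually_atTop.1 ((Filter.eventually_ge_atTop 1).and
    ((MSA.eventually_const_mul_rpow_le (show -ϑ < 0 by linarith) (4 * n / c₀)).and
      (MSA.eventually_const_mul_rpow_le (show -ϑ < -(ϑ / 2) by linarith) (2 * n + 2))))
  refine ⟨max (max N₁ N₂) N₃, fun c₂ hc hc' A hA N hN Λ₀ hΛ₀ hnorm hbad => ?_⟩
  have hNN₁ : N₁ ≤ N := (le_max_left _ _).trans ((le_max_left _ _).trans hN)
  have hNN₂ : N₂ ≤ N := (le_max_right _ _).trans ((le_max_left _ _).trans hN)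
  obtain ⟨hN1, h5, h6⟩ := hN₃ N ((le_max_right _ _).trans hN)
  have hx0 : (0 : ℝ) < N := by exact_mod_cast hN1
  set η := (N : ℝ) ^ (-ϑ) with hη
  have hη0 : 0 ≤ η := by positivity
  have hnη : 0 ≤ 2 * n * η := by positivity
  have h7 : 2 * n * η ≤ c₀ / 2 := by
    rw [Real.rpow_zero, div_mul_eq_mul_div, div_le_one hc₀] at h5
    linarith
  have hbad0 : MSA.BadCount A c₂ σ' ξ ς N Λ₀ := by
    intro F hF hFd
    have h8 := hbad F (fun Λ hΛ => ⟨(hF Λ hΛ).1, (hF Λ hΛ).2.1⟩) hFd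
    have h9 : {Λ ∈ (F : Set (Finset (Fin d → ℤ))) |
        ¬ MSA.GreenDecay A c₂ σ' ⌊(N : ℝ) ^ ξ⌋₊ Λ} = F := by
      ext Λ
      simp only [Set.mem_ofPred_eq, Finset.mem_coe, and_iff_left_iff_imp]
      exact fun hΛ => (hF Λ hΛ).2.2
    rw [h9, Set.ncard_coe_finset] at h8
    rwa [Real.rpow_sub hx0]
  have hcount := hN₁ N hNN₁ c₂ A Λ₀ (by linarith) hc' hA hnorm hbad0
  rw [hnδ] at hcount
  have hfin := hN₂ N hNN₂ _ A Λ₀ hΛ₀ (by linarith) (by linarith) hA hnorm hcount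
  refine ⟨hfin.1, fun x y hxy => (hfin.2 x y hxy).trans (Real.exp_le_exp.2 ?_)⟩
  refine mul_le_mul_of_nonneg_right ?_ (by positivity)
  rw [← hη]
  linarith
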